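/- **Conventions.** Manifolds are Hausdorff and modelled on (real, Hausdorff) locally convex spaces, and a map $f$ between open subsets of such spaces is smooth if all iterated directional derivatives $f, df, d(df),\dots$ exist and are continuous (on $U$, $U\times E$, …). Lie groups are groups in this category; no connectedness, dimension or completeness is assumed. A *2-group* $\mathcal G$ is a small category (objects $\mathcal G_0$, morphisms $\mathcal G_1$, structure maps $s,t,\mathrm{id},\circ$) with a multiplication functor $\otimes$, an inversion functor $g\mapsto\bar g$, a unit object $\mathbb 1$ and a natural isomorphism $\alpha_{g,h,k}:(g\otimes h)\otimes k\to g\otimes(h\otimes k)$ such that, on objects and morphisms, $g\otimes\mathbb 1=g=\mathbb 1\otimes g$ and $g\otimes\bar g=\mathbb 1=\bar g\otimes g$, the pentagon identity holds, $\alpha_{g,h,k}$ is an identity if $g$, $h$ or $k$ is $\mathbb 1$, and $\alpha_{g,\bar g,g}$, $\alpha_{\bar g,g,\bar g}$ are identities. A *morphism* is a functor $F$ with $F(\mathbb 1)=\mathbb 1$ and a natural isomorphism $F_2(g,h):F(g)\otimes F(h)\to F(g\otimes h)$, compatible with the associators, such that $F_2(g,\mathbb 1)$, $F_2(\mathbb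 1,g)$, $F_2(g,\bar g)$, $F_2(\bar g,g)$ are identities. A *Lie 2-group* is a 2-group whose underlying category is internal to manifolds (the sets of composable pairs and triples being fibre products in the category of manifolds) and whose functors $\otimes$, $\bar{\ }$ and natural isomorphism $\alpha$ are smooth on some open subcategory containing $\mathbb 1$. Morphisms of Lie 2-groups are morphisms of 2-groups that are smooth on some open subcategory containing $\mathbb 1$. **Smooth generalised central extensions.** Let $G$ be a Lie group, let $\tau:A\to Z$ be a smooth homomorphism of abelian Lie groups with $A$ discrete, and let $\mathcal Z$ be the strict 2-group with objects $Z$, morphisms $(a,x):x\to\tau(a)+x$ for $(a,x)\in A\times Z$, and $\otimes$ given by addition. Let $\underline G$ be the 2-group with objects $G$ and only identity morphisms. A smooth generalised central extension consists of a Lie 2-group $\hat{\mathcal G}$ and morphisms of Lie 2-groups $\mathcal Z\xrightarrow{\iota}\hat{\mathcal G}\xrightarrow{q}\underline G$ such that * on morphisms, $\iota$ is injective, $q$ is surjective, and $\operatorname{im}(\iota)=q^{-1}(\mathbb 1)$; * near the unit, $\iota$ is a diffeomorphism onto its image: there are an open neighbourhood $N$ of $\mathrm{id}_{\mathbb 1}$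 in $\hat{\mathcal G}_1$ and a smooth map $r:N\to A\times Z$ with $r(\iota(c))=c$ for every morphism $c$ of $\mathcal Z$ with $\iota(c)\in N$; * $\iota(a)\otimes g=g\otimes\iota(a)$ for all morphisms $a$ of $\mathcal Z$ and $g$ of $\hat{\mathcal G}$; * on some open unit neighbourhood $U\subseteq G$ there is a smooth functor $\sigma:\underline U\to\hat{\mathcal G}$ with $\sigma(1)=\mathbb 1$ and $q\circ\sigma=\mathrm{id}_{\underline U}$. **The Lie functor.** If, for a Lie 2-group $\mathcal G$, the differentials of $s$ and $t$ at $\mathrm{id}_{\mathbb 1}$ agree and are inverse to the differential of $\mathrm{id}:\mathcal G_0\to\mathcal G_1$ at $\mathbb 1$ (as is the case if $\mathcal G$ is étale), then the tangent category at the unit is just the vector space $\mathcal L(\mathcal G)=T_{\mathbb 1}\mathcal G_0$. Let $m_0:\mathcal G_0\times\mathcal G_0\to\mathcal G_0$ be $\otimes$ on objects, and let $b(x,y)=\tfrac12 d^2m_0\big((x,y),(x,y)\big)$ be its second order Taylor monomial at $(\mathbb 1,\mathbb 1)$ in a chart. Put $[x,y]=b(x,y)-b(y,x)$, and for a morphism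 $F$ let $\mathcal L(F)=dF_0(\mathbb 1)$. **Proposition.** Let $\mathcal Z\xrightarrow{\iota}\hat{\mathcal G}\xrightarrow{q}\underline G$ be a smooth generalised central extension. Then the above condition on the differentials of $s,t,\mathrm{id}$ holds for $\mathcal Z$, $\hat{\mathcal G}$ and $\underline G$; the brackets make $\mathcal L(\mathcal Z)$, $\mathcal L(\hat{\mathcal G})$ and $\mathcal L(\underline G)$ into locally convex Lie algebras (the bracket is continuous, bilinear, alternating and satisfies the Jacobi identity); and $$\mathcal L(\mathcal Z)\xrightarrow{\mathcal L(\iota)}\mathcal L(\hat{\mathcal G})\xrightarrow{\mathcal L(q)}\mathcal L(\underline G)$$ is a central extension of locally convex Lie algebras: $\mathcal L(\iota)$ and $\mathcal L(q)$ are continuous Lie algebra homomorphisms, $\mathcal L(\iota)$ is a topological embedding onto $\ker\mathcal L(q)$, $\mathcal L(q)$ is surjective and has a continuous linear section, and $[\mathcal L(\iota)z,x]=0$ for all $z\in\mathcal L(\mathcal Z)$, $x\in\mathcal L(\hat{\mathcal G})$. -/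

import Mathlib

open Filter Topology Set

universe u v

/-! ### Differential calculus on locally convex spaces -/

section Calculus

variable {E : Type u} {F : Type v} [AddCommGroup E] [Module ℝ E] [TopologicalSpace E]
  [AddCommGroup F] [Module ℝ F] [TopologicalSpace F]

/-- The differential quotient `(f (x + h v) - f x) / h`. -/
noncomputable def diffQuot (f : E → F) (x w : E) (h : ℝ) : F := h⁻¹ • (f (x + h • w) - f x)

/-- The directional derivative `df(x).w`, the limit of the differential quotients
(meaningful only where the limit exists). -/
noncomputable def dirDeriv (f : E → F) (x w : E) : F :=
  limUnder (𝓝[≠] (0 : ℝ)) (diffQuot f x w)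

/-- The second derivative `d²f(x)(w, w')`. -/
noncomputable def dirDeriv₂ (f : E → F) (x w w' : E) : F :=
  dirDeriv (fun y => dirDeriv f y w) x w'

end Calculus

/-- `f` is `Cⁿ` on the open set `U`: it is continuous and, if `n > 0`, all its directional
derivatives exist on `U` and `df : U × E → F` is `Cⁿ⁻¹`. -/
def IsCDiffOn : ℕ → ∀ {E : Type u} {F : Type v} [AddCommGroup E] [Module ℝ E]
    [TopologicalSpace E] [AddCommGroup F] [Module ℝ F] [TopologicalSpace F],
    (E → F) → Set E → Prop
  | 0, _, _, _, _, _, _, _, _, f, U => ContinuousOn f U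
  | n + 1, E, _, _, _, _, _, _, _, f, U =>
      ContinuousOn f U ∧
      (∀ x ∈ U, ∀ w : E, ∃ y, Tendsto (diffQuot f x w) (𝓝[≠] (0 : ℝ)) (𝓝 y)) ∧
      IsCDiffOn n (fun p : E × E => dirDeriv f p.1 p.2) (U ×ˢ (univ : Set E))

/-- Smooth maps between open subsets of locally convex spaces. -/
def IsCInftyOn {E : Type u} {F : Type v} [AddCommGroup E] [Module ℝ E]
    [TopologicalSpace E] [AddCommGroup F] [Module ℝ F] [TopologicalSpace F]
    (f : E → F) (U : Set E) : Prop := ∀ n, IsCDiffOn n f U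

/-- Helper: the product of two `Cⁿ` maps, precomposed with a continuous linear map, is `Cⁿ`. -/
theorem isCDiffOn_prodMap_comp (n : ℕ) : ∀ {D E E' : Type u} {F F' : Type v}
    [AddCommGroup D] [Module ℝ D] [TopologicalSpace D] [IsTopologicalAddGroup D]
    [ContinuousSMul ℝ D]
    [AddCommGroup E] [Module ℝ E] [TopologicalSpace E]
    [AddCommGroup E'] [Module ℝ E'] [TopologicalSpace E']
    [AddCommGroup F] [Module ℝ F] [TopologicalSpace F] [T2Space F]
    [AddCommGroup F'] [Module ℝ F'] [TopologicalSpace F'] [T2Space F']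
    (f : E → F) (g : E' → F') (U : Set E) (V : Set E') (L : D →L[ℝ] E × E')
    (k : D → F × F') (W : Set D) (_ : IsOpen W) (_ : W = L ⁻¹' (U ×ˢ V))
    (_ : ∀ x ∈ W, k x = (f (L x).1, g (L x).2))
    (_ : IsCDiffOn n f U) (_ : IsCDiffOn n g V), IsCDiffOn n k W := by
  induction n with
  | zero =>
    intro D E E' F F' _ _ _ _ _ _ _ _ _ _ _ _ _ _ _ _ _ _ _ f g U V L k W hWo hW hk hf hg
    have h1 : ContinuousOn (fun x => (f (L x).1, g (L x).2)) W := by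
      refine ContinuousOn.prodMk (f := fun x => f (L x).1) (g := fun x => g (L x).2) ?_ ?_
      · exact ContinuousOn.comp hf (by fun_prop) (by rw [hW]; intro x hx; exact hx.1)
      · exact ContinuousOn.comp hg (by fun_prop) (by rw [hW]; intro x hx; exact hx.2)
    exact h1.congr hk
  | succ n ih =>
    intro D E E' F F' _ _ _ _ _ _ _ _ _ _ _ _ _ _ _ _ _ _ _ f g U V L k W hWo hW hk hf hg
    obtain ⟨hf0, hf1, hf2⟩ := hf
    obtain ⟨hg0, hg1, hg2⟩ := hg
    have h1 : ContinuousOn (fun x => (f (L x).1, g (L x).2)) W := by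
      refine ContinuousOn.prodMk (f := fun x => f (L x).1) (g := fun x => g (L x).2) ?_ ?_
      · exact ContinuousOn.comp hf0 (by fun_prop) (by rw [hW]; intro x hx; exact hx.1)
      · exact ContinuousOn.comp hg0 (by fun_prop) (by rw [hW]; intro x hx; exact hx.2)
    have hlim : ∀ x ∈ W, ∀ w, Tendsto (diffQuot k x w) (𝓝[≠] (0 : ℝ))
        (𝓝 (dirDeriv f (L x).1 (L w).1, dirDeriv g (L x).2 (L w).2)) := by
      intro x hx w
      have hx' : (L x).1 ∈ U ∧ (L x).2 ∈ V := by rw [hW] at hx; exact hx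
      have a := tendsto_nhds_limUnder (hf1 _ hx'.1 (L w).1)
      have b := tendsto_nhds_limUnder (hg1 _ hx'.2 (L w).2)
      have hc : Tendsto (fun h : ℝ => x + h • w) (𝓝 0) (𝓝 x) := by
        have : Continuous (fun h : ℝ => x + h • w) := by fun_prop
        simpa using this.tendsto 0
      refine (a.prodMk_nhds b).congr' ?_
      filter_upwards [nhdsWithin_le_nhds (hc (hWo.mem_nhds hx))] with h hh
      simp only [diffQuot, hk _ hh, hk x hx]
      ext <;> simp
    refine ⟨h1.congr hk, fun x hx w => ⟨_, hlim x hx w⟩, ?_⟩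
    refine ih (fun p : E × E => dirDeriv f p.1 p.2) (fun p : E' × E' => dirDeriv g p.1 p.2)
      (U ×ˢ univ) (V ×ˢ univ)
      ((((ContinuousLinearMap.fst ℝ E E').comp (L.comp (ContinuousLinearMap.fst ℝ D D))).prod
        ((ContinuousLinearMap.fst ℝ E E').comp (L.comp (ContinuousLinearMap.snd ℝ D D)))).prod
       (((ContinuousLinearMap.snd ℝ E E').comp (L.comp (ContinuousLinearMap.fst ℝ D D))).prod
        ((ContinuousLinearMap.snd ℝ E E').comp (L.comp (ContinuousLinearMap.snd ℝ D D)))))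
      _ _ (hWo.prod isOpen_univ) ?_ ?_ hf2 hg2
    · ext p
      simp [hW]
    · intro p hp
      exact (hlim p.1 hp.1 p.2).limUnder_eq

/-- Helper: products of smooth maps are smooth. -/
theorem IsCInftyOn.prodMap {E E' : Type u} {F F' : Type v}
    [AddCommGroup E] [Module ℝ E] [TopologicalSpace E] [IsTopologicalAddGroup E]
    [ContinuousSMul ℝ E]
    [AddCommGroup E'] [Module ℝ E'] [TopologicalSpace E'] [IsTopologicalAddGroup E']
    [ContinuousSMul ℝ E']
    [AddCommGroup F] [Module ℝ F] [TopologicalSpace F] [T2Space F]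
    [AddCommGroup F'] [Module ℝ F'] [TopologicalSpace F'] [T2Space F']
    {f : E → F} {g : E' → F'} {U : Set E} {V : Set E'} (hU : IsOpen U) (hV : IsOpen V)
    (hf : IsCInftyOn f U) (hg : IsCInftyOn g V) :
    IsCInftyOn (Prod.map f g) (U ×ˢ V) := fun n =>
  isCDiffOn_prodMap_comp n f g U V (ContinuousLinearMap.id ℝ (E × E')) _ _ (hU.prod hV)
    (by ext; simp) (fun _ _ => rfl) (hf n) (hg n)

/-! ### Manifolds modelled on locally convex spaces -/

/-- A smooth manifold: a Hausdorff space with an atlas of charts in a (Hausdorff, real) locally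
convex space `Model M`, with smooth changes of charts. -/
class LCManifold (M : Type u) [TopologicalSpace M] : Type (u + 1) where
  /-- The model space. -/
  Model : Type u
  [addCommGroup : AddCommGroup Model]
  [module : Module ℝ Model]
  [topologicalSpace : TopologicalSpace Model]
  [isTopologicalAddGroup : IsTopologicalAddGroup Model]
  [continuousSMul : ContinuousSMul ℝ Model]
  [locallyConvexSpace : LocallyConvexSpace ℝ Model]
  [t2Space_model : T2Space Model]
  [t2Space : T2Space M]
  [chartedSpace : ChartedSpace Model M]
  compat : ∀ e ∈ atlas Model M, ∀ e' ∈ atlas Model M,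
    IsCInftyOn (e.symm.trans e') (e.symm.trans e').source

open LCManifold (Model)

attribute [reducible] LCManifold.addCommGroup LCManifold.module LCManifold.topologicalSpace
  LCManifold.chartedSpace

attribute [instance] LCManifold.addCommGroup LCManifold.module LCManifold.topologicalSpace
  LCManifold.isTopologicalAddGroup LCManifold.continuousSMul LCManifold.locallyConvexSpace
  LCManifold.t2Space_model LCManifold.chartedSpace

/-- The product of two manifolds, with the products of charts as charts. -/
instance LCManifold.prod (M N : Type u) [TopologicalSpace M] [TopologicalSpace N]
    [LCManifold M] [LCManifold N] : LCManifold (M × N) where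
  Model := Model M × Model N
  t2Space :=
    haveI := LCManifold.t2Space (M := M)
    haveI := LCManifold.t2Space (M := N)
    inferInstance
  chartedSpace := prodChartedSpace (Model M) M (Model N) N
  compat := by
    rintro _ ⟨e₁, h₁, e₂, h₂, rfl⟩ _ ⟨e₁', h₁', e₂', h₂', rfl⟩
    have h := IsCInftyOn.prodMap (e₁.symm.trans e₁').open_source (e₂.symm.trans e₂').open_source
      (LCManifold.compat e₁ h₁ e₁' h₁') (LCManifold.compat e₂ h₂ e₂' h₂')
    rw [OpenPartialHomeomorph.prod_symm, OpenPartialHomeomorph.prod_trans]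
    exact h

section Maps

variable {M N : Type u} [TopologicalSpace M] [TopologicalSpace N] [LCManifold M] [LCManifold N]

/-- `f` is smooth on the open set `S`: it is continuous there and smooth in all charts. -/
def SmoothOnSet (f : M → N) (S : Set M) : Prop :=
  ContinuousOn f S ∧
  ∀ e ∈ atlas (Model M) M, ∀ e' ∈ atlas (Model N) N,
    IsCInftyOn (fun x => e' (f (e.symm x))) (e.target ∩ e.symm ⁻¹' (S ∩ f ⁻¹' e'.source))

/-- Globally smooth maps. -/
def SmoothMap (f : M → N) : Prop := SmoothOnSet f univ

/-- The coordinate expression of `f`, with `f p = q`, in the preferred charts at `p` and `q`. -/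
noncomputable def coordRep (f : M → N) (p : M) (q : N) : Model M → Model N := fun x =>
  chartAt (Model N) q (f ((chartAt (Model M) p).symm x))

/-- The differential `T_p M → T_q N` of `f` at the base point `p`, where `f p = q`.  The tangent
space at a point is the model space, identified through the preferred chart at the point. -/
noncomputable def pointedDiff (f : M → N) (p : M) (q : N) (w : Model M) : Model N :=
  dirDeriv (coordRep f p q) (chartAt (Model M) p p) w

/-- The second order Taylor monomial `w ↦ ½ d²f(w, w)` of `f` at the base point `p`,
where `f p = q`. -/
noncomputable def pointedTaylor₂ (f : M → N) (p : M) (q : N) (w : Model M) : Model N :=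
  (1 / 2 : ℝ) • dirDeriv₂ (coordRep f p q) (chartAt (Model M) p p) w w

end Maps

/-- A (locally convex) Lie group. -/
class IsLCLieGroup (G : Type u) [Group G] [TopologicalSpace G] [LCManifold G] : Prop where
  smooth_mul : SmoothMap (fun p : G × G => p.1 * p.2)
  smooth_inv : SmoothMap (fun g : G => g⁻¹)

/-- An abelian (locally convex) Lie group, written additively. -/
class IsLCLieAddGroup (Z : Type u) [AddCommGroup Z] [TopologicalSpace Z] [LCManifold Z] :
    Prop where
  smooth_add : SmoothMap (fun p : Z × Z => p.1 + p.2)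
  smooth_neg : SmoothMap (fun z : Z => -z)

/-! ### Small categories and 2-groups -/

/-- A small category with set of objects `C₀` and set of morphisms `C₁`; `comp f g _` is the
composite `f ∘ g`, defined if the source of `f` is the target of `g`. -/
structure SmallCat (C₀ C₁ : Type u) where
  src : C₁ → C₀
  tgt : C₁ → C₀
  idm : C₀ → C₁
  comp : ∀ f g : C₁, src f = tgt g → C₁
  src_idm : ∀ x, src (idm x) = x
  tgt_idm : ∀ x, tgt (idm x) = x
  src_comp : ∀ f g h, src (comp f g h) = src g
  tgt_comp : ∀ f g h, tgt (comp f g h) = tgt f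
  idm_comp : ∀ f h, comp (idm (tgt f)) f h = f
  comp_idm : ∀ f h, comp f (idm (src f)) h = f
  comp_assoc : ∀ f g k h₁ h₂ h₃ h₄, comp (comp f g h₁) k h₂ = comp f (comp g k h₃) h₄

/-- A (unital) 2-group: multiplication functor `mul₀, mul₁`, inversion functor `inv₀, inv₁`, unit
object `one` and associator `assoc`, with inverse `assocInv`.  In the equations between composites,
the quantified hypotheses (composability) follow from the other axioms. -/
structure TwoGroup (C₀ C₁ : Type u) extends SmallCat C₀ C₁ where
  one : C₀
  mul₀ : C₀ → C₀ → C₀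
  mul₁ : C₁ → C₁ → C₁
  inv₀ : C₀ → C₀
  inv₁ : C₁ → C₁
  assoc : C₀ → C₀ → C₀ → C₁
  assocInv : C₀ → C₀ → C₀ → C₁
  -- multiplication is a functor
  src_mul : ∀ f g, src (mul₁ f g) = mul₀ (src f) (src g)
  tgt_mul : ∀ f g, tgt (mul₁ f g) = mul₀ (tgt f) (tgt g)
  idm_mul : ∀ x y, mul₁ (idm x) (idm y) = idm (mul₀ x y)
  comp_mul : ∀ f g f' g' h h' h'',
    mul₁ (comp f g h) (comp f' g' h') = comp (mul₁ f f') (mul₁ g g') h''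
  -- inversion is a functor
  src_inv : ∀ f, src (inv₁ f) = inv₀ (src f)
  tgt_inv : ∀ f, tgt (inv₁ f) = inv₀ (tgt f)
  idm_inv : ∀ x, inv₁ (idm x) = idm (inv₀ x)
  comp_inv : ∀ f g h h', inv₁ (comp f g h) = comp (inv₁ f) (inv₁ g) h'
  -- strict units and strict inverses, on objects and on morphisms
  mul_one₀ : ∀ x, mul₀ x one = x
  one_mul₀ : ∀ x, mul₀ one x = x
  mul_one₁ : ∀ f, mul₁ f (idm one) = f
  one_mul₁ : ∀ f, mul₁ (idm one) f = f
  mul_inv₀ : ∀ x, mul₀ x (inv₀ x) = one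
  inv_mul₀ : ∀ x, mul₀ (inv₀ x) x = one
  mul_inv₁ : ∀ f, mul₁ f (inv₁ f) = idm one
  inv_mul₁ : ∀ f, mul₁ (inv₁ f) f = idm one
  -- the associator is a natural isomorphism
  src_assoc : ∀ x y z, src (assoc x y z) = mul₀ (mul₀ x y) z
  tgt_assoc : ∀ x y z, tgt (assoc x y z) = mul₀ x (mul₀ y z)
  assoc_comp_assocInv : ∀ x y z h,
    comp (assoc x y z) (assocInv x y z) h = idm (mul₀ x (mul₀ y z))
  assocInv_comp_assoc : ∀ x y z h,
    comp (assocInv x y z) (assoc x y z) h = idm (mul₀ (mul₀ x y) z)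
  src_assocInv : ∀ x y z, src (assocInv x y z) = mul₀ x (mul₀ y z)
  tgt_assocInv : ∀ x y z, tgt (assocInv x y z) = mul₀ (mul₀ x y) z
  assoc_natural : ∀ f g k h h',
    comp (assoc (tgt f) (tgt g) (tgt k)) (mul₁ (mul₁ f g) k) h =
      comp (mul₁ f (mul₁ g k)) (assoc (src f) (src g) (src k)) h'
  -- coherence
  pentagon : ∀ x y z w h₁ h₂ h₃,
    comp (assoc x y (mul₀ z w)) (assoc (mul₀ x y) z w) h₁ =
      comp (mul₁ (idm x) (assoc y z w))
        (comp (assoc x (mul₀ y z) w) (mul₁ (assoc x y z) (idm w)) h₂) h₃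
  assoc_one_left : ∀ y z, assoc one y z = idm (mul₀ y z)
  assoc_one_mid : ∀ x z, assoc x one z = idm (mul₀ x z)
  assoc_one_right : ∀ x y, assoc x y one = idm (mul₀ x y)
  assoc_inv : ∀ x, assoc x (inv₀ x) x = idm x
  assoc_inv' : ∀ x, assoc (inv₀ x) x (inv₀ x) = idm (inv₀ x)

/-- A morphism of 2-groups: a functor `obj, mor` with a natural isomorphism
`mul₂ x y : F x ⊗ F y → F (x ⊗ y)`, with inverse `mul₂Inv`. -/
structure TwoGroupHom {C₀ C₁ D₀ D₁ : Type u} (𝒢 : TwoGroup C₀ C₁) (ℋ : TwoGroup D₀ D₁) where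
  obj : C₀ → D₀
  mor : C₁ → D₁
  mul₂ : C₀ → C₀ → D₁
  mul₂Inv : C₀ → C₀ → D₁
  -- functor
  src_mor : ∀ f, ℋ.src (mor f) = obj (𝒢.src f)
  tgt_mor : ∀ f, ℋ.tgt (mor f) = obj (𝒢.tgt f)
  mor_idm : ∀ x, mor (𝒢.idm x) = ℋ.idm (obj x)
  mor_comp : ∀ f g h h', mor (𝒢.comp f g h) = ℋ.comp (mor f) (mor g) h'
  -- natural isomorphism
  src_mul₂ : ∀ x y, ℋ.src (mul₂ x y) = ℋ.mul₀ (obj x) (obj y)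
  tgt_mul₂ : ∀ x y, ℋ.tgt (mul₂ x y) = obj (𝒢.mul₀ x y)
  src_mul₂Inv : ∀ x y, ℋ.src (mul₂Inv x y) = obj (𝒢.mul₀ x y)
  tgt_mul₂Inv : ∀ x y, ℋ.tgt (mul₂Inv x y) = ℋ.mul₀ (obj x) (obj y)
  mul₂_comp_mul₂Inv : ∀ x y h, ℋ.comp (mul₂ x y) (mul₂Inv x y) h = ℋ.idm (obj (𝒢.mul₀ x y))
  mul₂Inv_comp_mul₂ : ∀ x y h,
    ℋ.comp (mul₂Inv x y) (mul₂ x y) h = ℋ.idm (ℋ.mul₀ (obj x) (obj y))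
  mul₂_natural : ∀ f g h h',
    ℋ.comp (mul₂ (𝒢.tgt f) (𝒢.tgt g)) (ℋ.mul₁ (mor f) (mor g)) h =
      ℋ.comp (mor (𝒢.mul₁ f g)) (mul₂ (𝒢.src f) (𝒢.src g)) h'
  -- units and inverses
  obj_one : obj 𝒢.one = ℋ.one
  mul₂_one_right : ∀ x, mul₂ x 𝒢.one = ℋ.idm (obj x)
  mul₂_one_left : ∀ x, mul₂ 𝒢.one x = ℋ.idm (obj x)
  mul₂_inv_right : ∀ x, mul₂ x (𝒢.inv₀ x) = ℋ.idm ℋ.one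
  mul₂_inv_left : ∀ x, mul₂ (𝒢.inv₀ x) x = ℋ.idm ℋ.one
  -- coherence
  coherence : ∀ x y z h₁ h₂ h₃ h₄,
    ℋ.comp (mul₂ x (𝒢.mul₀ y z))
        (ℋ.comp (ℋ.mul₁ (ℋ.idm (obj x)) (mul₂ y z)) (ℋ.assoc (obj x) (obj y) (obj z)) h₁) h₂ =
      ℋ.comp (mor (𝒢.assoc x y z))
        (ℋ.comp (mul₂ (𝒢.mul₀ x y) z) (ℋ.mul₁ (mul₂ x y) (ℋ.idm (obj z))) h₃) h₄

/-- The 2-group with objects the group `G` and only identity morphisms. -/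
def discreteTwoGroup (G : Type u) [Group G] : TwoGroup G G where
  src := id
  tgt := id
  idm := id
  comp f _ _ := f
  src_idm _ := rfl
  tgt_idm _ := rfl
  src_comp _ _ h := h
  tgt_comp _ _ _ := rfl
  idm_comp _ _ := rfl
  comp_idm _ _ := rfl
  comp_assoc _ _ _ _ _ _ _ := rfl
  one := 1
  mul₀ g h := g * h
  mul₁ g h := g * h
  inv₀ g := g⁻¹
  inv₁ g := g⁻¹
  assoc x y z := x * y * z
  assocInv x y z := x * y * z
  src_mul _ _ := rfl
  tgt_mul _ _ := rfl
  idm_mul _ _ := rfl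
  comp_mul _ _ _ _ _ _ _ := rfl
  src_inv _ := rfl
  tgt_inv _ := rfl
  idm_inv _ := rfl
  comp_inv _ _ _ _ := rfl
  mul_one₀ := mul_one
  one_mul₀ := one_mul
  mul_one₁ := mul_one
  one_mul₁ := one_mul
  mul_inv₀ := mul_inv_cancel
  inv_mul₀ := inv_mul_cancel
  mul_inv₁ := mul_inv_cancel
  inv_mul₁ := inv_mul_cancel
  src_assoc _ _ _ := rfl
  tgt_assoc := mul_assoc
  assoc_comp_assocInv x y z _ := mul_assoc x y z
  assocInv_comp_assoc _ _ _ _ := rfl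
  src_assocInv := mul_assoc
  tgt_assocInv _ _ _ := rfl
  assoc_natural f g k _ _ := mul_assoc f g k
  pentagon x y z w _ _ _ := by simp [mul_assoc]
  assoc_one_left := by simp
  assoc_one_mid := by simp
  assoc_one_right := by simp
  assoc_inv := by simp
  assoc_inv' := by simp

/-- The abelian strict 2-group of a homomorphism `τ : A → Z` of abelian groups: the objects are
the elements of `Z`, and `(a, x)` is a morphism from `x` to `τ a + x`. -/
def abelianTwoGroup {A Z : Type u} [AddCommGroup A] [AddCommGroup Z] (τ : A →+ Z) :
    TwoGroup Z (A × Z) where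
  src f := f.2
  tgt f := τ f.1 + f.2
  idm x := (0, x)
  comp f g _ := (f.1 + g.1, g.2)
  src_idm _ := rfl
  tgt_idm x := by simp
  src_comp _ _ _ := rfl
  tgt_comp f g h := by simp only [h, map_add]; abel
  idm_comp f h := by simp
  comp_idm f h := by simp
  comp_assoc f g k _ _ _ _ := by simp [add_assoc]
  one := 0
  mul₀ x y := x + y
  mul₁ f g := f + g
  inv₀ x := -x
  inv₁ f := -f
  assoc x y z := (0, x + y + z)
  assocInv x y z := (0, x + y + z)
  src_mul _ _ := rfl
  tgt_mul f g := by simp only [Prod.fst_add, Prod.snd_add, map_add]; abel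
  idm_mul x y := by simp
  comp_mul f g f' g' _ _ _ := by
    ext
    · simp only [Prod.fst_add]; abel
    · simp
  src_inv _ := rfl
  tgt_inv f := by simp only [Prod.fst_neg, Prod.snd_neg, map_neg]; abel
  idm_inv x := by simp
  comp_inv f g _ _ := by
    ext
    · simp only [Prod.fst_neg]; abel
    · simp
  mul_one₀ := add_zero
  one_mul₀ := zero_add
  mul_one₁ := add_zero
  one_mul₁ := zero_add
  mul_inv₀ := add_neg_cancel
  inv_mul₀ := neg_add_cancel
  mul_inv₁ := add_neg_cancel
  inv_mul₁ := neg_add_cancel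
  src_assoc _ _ _ := rfl
  tgt_assoc x y z := by simp [add_assoc]
  assoc_comp_assocInv x y z _ := by simp [add_assoc]
  assocInv_comp_assoc x y z _ := by simp
  src_assocInv x y z := by simp [add_assoc]
  tgt_assocInv x y z := by simp
  assoc_natural f g k _ _ := by
    ext
    · simp [add_assoc]
    · simp
  pentagon x y z w _ _ _ := by simp [add_assoc]
  assoc_one_left := by simp
  assoc_one_mid := by simp
  assoc_one_right := by simp
  assoc_inv := by simp
  assoc_inv' := by simp

/-! ### Smooth 2-spaces and Lie 2-groups -/

/-- Composable pairs of morphisms, the fibre product of `src` and `tgt`. -/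
@[ext]
structure SmallCat.Comp₂ {C₀ C₁ : Type u} (𝒞 : SmallCat C₀ C₁) : Type u where
  fst : C₁
  snd : C₁
  src_fst : 𝒞.src fst = 𝒞.tgt snd

/-- Composable triples of morphisms. -/
@[ext]
structure SmallCat.Comp₃ {C₀ C₁ : Type u} (𝒞 : SmallCat C₀ C₁) : Type u where
  fst : C₁
  snd : C₁
  trd : C₁
  src_fst : 𝒞.src fst = 𝒞.tgt snd
  src_snd : 𝒞.src snd = 𝒞.tgt trd

/-- A subcategory, with objects `U₀` and morphisms `U₁`, both open. -/
structure SmallCat.IsOpenSubcat {C₀ C₁ : Type u} [TopologicalSpace C₀] [TopologicalSpace C₁]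
    (𝒞 : SmallCat C₀ C₁) (U₀ : Set C₀) (U₁ : Set C₁) : Prop where
  isOpen_obj : IsOpen U₀
  isOpen_mor : IsOpen U₁
  src_mem : ∀ f ∈ U₁, 𝒞.src f ∈ U₀
  tgt_mem : ∀ f ∈ U₁, 𝒞.tgt f ∈ U₀
  idm_mem : ∀ x ∈ U₀, 𝒞.idm x ∈ U₁
  comp_mem : ∀ f ∈ U₁, ∀ g ∈ U₁, ∀ h, 𝒞.comp f g h ∈ U₁

section Smooth

variable {C₀ C₁ D₀ D₁ : Type u}
  [TopologicalSpace C₀] [LCManifold C₀] [TopologicalSpace C₁] [LCManifold C₁]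
  [TopologicalSpace D₀] [LCManifold D₀] [TopologicalSpace D₁] [LCManifold D₁]

/-- A smooth 2-space, that is, a category internal to smooth manifolds: source, target, identity
and composition are smooth, where the sets of composable pairs and triples are manifolds that are
fibre products in the category of manifolds.  (The maps between these that are induced by
composition and the projections are then smooth as well.) -/
structure SmallCat.IsSmoothTwoSpace (𝒞 : SmallCat C₀ C₁) : Prop where
  smooth_src : SmoothMap 𝒞.src
  smooth_tgt : SmoothMap 𝒞.tgt
  smooth_idm : SmoothMap 𝒞.idm
  pullback₂ : ∃ (_ : TopologicalSpace 𝒞.Comp₂) (_ : LCManifold 𝒞.Comp₂),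
    (∀ (T : Type u) [TopologicalSpace T] [LCManifold T] (φ : T → 𝒞.Comp₂),
      SmoothMap φ ↔ SmoothMap (fun t => (φ t).fst) ∧ SmoothMap (fun t => (φ t).snd)) ∧
    SmoothMap (fun p : 𝒞.Comp₂ => 𝒞.comp p.fst p.snd p.src_fst)
  pullback₃ : ∃ (_ : TopologicalSpace 𝒞.Comp₃) (_ : LCManifold 𝒞.Comp₃),
    ∀ (T : Type u) [TopologicalSpace T] [LCManifold T] (φ : T → 𝒞.Comp₃),
      SmoothMap φ ↔ SmoothMap (fun t => (φ t).fst) ∧ SmoothMap (fun t => (φ t).snd) ∧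
        SmoothMap (fun t => (φ t).trd)

/-- A Lie 2-group: a 2-group on a smooth 2-space such that the group functors and the associator
are smooth on some open subcategory containing the unit. -/
structure TwoGroup.IsLie (𝒢 : TwoGroup C₀ C₁) : Prop where
  smoothTwoSpace : 𝒢.toSmallCat.IsSmoothTwoSpace
  locallySmooth : ∃ (U₀ : Set C₀) (U₁ : Set C₁), 𝒢.toSmallCat.IsOpenSubcat U₀ U₁ ∧
    𝒢.one ∈ U₀ ∧
    SmoothOnSet (fun p : C₀ × C₀ => 𝒢.mul₀ p.1 p.2) (U₀ ×ˢ U₀) ∧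
    SmoothOnSet (fun p : C₁ × C₁ => 𝒢.mul₁ p.1 p.2) (U₁ ×ˢ U₁) ∧
    SmoothOnSet 𝒢.inv₀ U₀ ∧
    SmoothOnSet 𝒢.inv₁ U₁ ∧
    SmoothOnSet (fun p : C₀ × C₀ × C₀ => 𝒢.assoc p.1 p.2.1 p.2.2) (U₀ ×ˢ U₀ ×ˢ U₀) ∧
    SmoothOnSet (fun p : C₀ × C₀ × C₀ => 𝒢.assocInv p.1 p.2.1 p.2.2) (U₀ ×ˢ U₀ ×ˢ U₀)

/-- A morphism of Lie 2-groups: a morphism of 2-groups that is smooth on some open subcategory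
containing the unit. -/
def TwoGroupHom.IsLie {𝒢 : TwoGroup C₀ C₁} {ℋ : TwoGroup D₀ D₁} (F : TwoGroupHom 𝒢 ℋ) : Prop :=
  ∃ (U₀ : Set C₀) (U₁ : Set C₁), 𝒢.toSmallCat.IsOpenSubcat U₀ U₁ ∧
    𝒢.one ∈ U₀ ∧
    SmoothOnSet F.obj U₀ ∧
    SmoothOnSet F.mor U₁ ∧
    SmoothOnSet (fun p : C₀ × C₀ => F.mul₂ p.1 p.2) (U₀ ×ˢ U₀) ∧
    SmoothOnSet (fun p : C₀ × C₀ => F.mul₂Inv p.1 p.2) (U₀ ×ˢ U₀)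

/-! ### The Lie functor -/

/-- The tangent category of `𝒢` at the unit has only identity morphisms: the differentials of the
identity map and of source and target at the unit are mutually inverse.  It is then the same as
the vector space `𝓛(𝒢) = T_𝟙 C₀`. -/
def TwoGroup.TangentDiscrete (𝒢 : TwoGroup C₀ C₁) : Prop :=
  (∀ x, pointedDiff 𝒢.src (𝒢.idm 𝒢.one) 𝒢.one (pointedDiff 𝒢.idm 𝒢.one (𝒢.idm 𝒢.one) x) = x) ∧
  (∀ y, pointedDiff 𝒢.idm 𝒢.one (𝒢.idm 𝒢.one) (pointedDiff 𝒢.src (𝒢.idm 𝒢.one) 𝒢.one y) = y) ∧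
  (∀ y, pointedDiff 𝒢.tgt (𝒢.idm 𝒢.one) 𝒢.one y = pointedDiff 𝒢.src (𝒢.idm 𝒢.one) 𝒢.one y)

/-- The second order Taylor monomial of the object multiplication at the unit, as a function of two
arguments. -/
noncomputable def TwoGroup.taylorMul (𝒢 : TwoGroup C₀ C₁) (x y : Model C₀) : Model C₀ :=
  pointedTaylor₂ (fun p : C₀ × C₀ => 𝒢.mul₀ p.1 p.2) (𝒢.one, 𝒢.one) 𝒢.one
    ((x, y) : Model C₀ × Model C₀)

/-- The Lie bracket of `𝓛(𝒢) = T_𝟙 C₀`. -/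
noncomputable def TwoGroup.lieBracket (𝒢 : TwoGroup C₀ C₁) (x y : Model C₀) : Model C₀ :=
  𝒢.taylorMul x y - 𝒢.taylorMul y x

/-- The map `𝓛(F) : 𝓛(𝒢) → 𝓛(ℋ)`, the differential of `F` on objects at the unit. -/
noncomputable def TwoGroupHom.lieMap {𝒢 : TwoGroup C₀ C₁} {ℋ : TwoGroup D₀ D₁}
    (F : TwoGroupHom 𝒢 ℋ) : Model C₀ → Model D₀ :=
  pointedDiff F.obj 𝒢.one ℋ.one

end Smooth

/-- `br` makes the locally convex space `L` into a locally convex Lie algebra: it is bilinear,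
continuous, alternating and satisfies the Jacobi identity. -/
structure IsLCLieBracket {L : Type u} [AddCommGroup L] [Module ℝ L] [TopologicalSpace L]
    (br : L → L → L) : Prop where
  continuous_br : Continuous (fun p : L × L => br p.1 p.2)
  add_left : ∀ x y z, br (x + y) z = br x z + br y z
  smul_left : ∀ (c : ℝ) x y, br (c • x) y = c • br x y
  add_right : ∀ x y z, br x (y + z) = br x y + br x z
  smul_right : ∀ (c : ℝ) x y, br x (c • y) = c • br x y
  alternating : ∀ x, br x x = 0
  jacobi : ∀ x y z, br x (br y z) + br y (br z x) + br z (br x y) = 0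

/-- A morphism of locally convex Lie algebras. -/
structure IsLCLieHom {L L' : Type u} [AddCommGroup L] [Module ℝ L] [TopologicalSpace L]
    [AddCommGroup L'] [Module ℝ L'] [TopologicalSpace L']
    (br : L → L → L) (br' : L' → L' → L') (f : L → L') : Prop where
  isLinear : IsLinearMap ℝ f
  continuous_map : Continuous f
  map_br : ∀ x y, f (br x y) = br' (f x) (f y)

/-- `L₁ → L₂ → L₃` is a central extension of locally convex Lie algebras (split as a sequence of
topological vector spaces). -/
structure IsCentralLieExtension {L₁ L₂ L₃ : Type u}
    [AddCommGroup L₁] [Module ℝ L₁] [TopologicalSpace L₁]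
    [AddCommGroup L₂] [Module ℝ L₂] [TopologicalSpace L₂]
    [AddCommGroup L₃] [Module ℝ L₃] [TopologicalSpace L₃]
    (br₁ : L₁ → L₁ → L₁) (br₂ : L₂ → L₂ → L₂) (br₃ : L₃ → L₃ → L₃)
    (i : L₁ → L₂) (p : L₂ → L₃) : Prop where
  lie₁ : IsLCLieBracket br₁
  lie₂ : IsLCLieBracket br₂
  lie₃ : IsLCLieBracket br₃
  hom_i : IsLCLieHom br₁ br₂ i
  hom_p : IsLCLieHom br₂ br₃ p
  embedding_i : IsEmbedding i
  exact : ∀ x, p x = 0 ↔ x ∈ range i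
  surjective_p : Function.Surjective p
  central : ∀ z x, br₂ (i z) x = 0
  split : ∃ σ : L₃ →L[ℝ] L₂, ∀ y, p (σ y) = y

/-! ### Smooth generalised central extensions -/

/-- A generalised central extension of `G` by the abelian 2-group of `τ : A → Z`. -/
structure IsGenCentralExt {A Z G C₀ C₁ : Type u} [AddCommGroup A] [AddCommGroup Z] [Group G]
    {τ : A →+ Z} {𝒢 : TwoGroup C₀ C₁} (ι : TwoGroupHom (abelianTwoGroup τ) 𝒢)
    (q : TwoGroupHom 𝒢 (discreteTwoGroup G)) : Prop where
  injective_mor : Function.Injective ι.mor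
  exact_mor : ∀ f : C₁, f ∈ range ι.mor ↔ q.mor f = 1
  surjective_mor : Function.Surjective q.mor
  central : ∀ (a : A × Z) (f : C₁), 𝒢.mul₁ (ι.mor a) f = 𝒢.mul₁ f (ι.mor a)

/-- A smooth generalised central extension: a generalised central extension of Lie 2-groups with a
smooth section `σ` of `q` on an open unit neighbourhood `U` of `G`, where `ι` is, near the unit, a
diffeomorphism onto its image.  The functor from the discrete category `U` is given by its map on
objects, since it sends the identity of `u` to the identity of `σ u`. -/
structure IsSmoothGenCentralExt {A Z G C₀ C₁ : Type u} [AddCommGroup A] [AddCommGroup Z] [Group G]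
    [TopologicalSpace A] [LCManifold A] [TopologicalSpace Z] [LCManifold Z]
    [TopologicalSpace G] [LCManifold G] [TopologicalSpace C₀] [LCManifold C₀]
    [TopologicalSpace C₁] [LCManifold C₁]
    {τ : A →+ Z} {𝒢 : TwoGroup C₀ C₁} (ι : TwoGroupHom (abelianTwoGroup τ) 𝒢)
    (q : TwoGroupHom 𝒢 (discreteTwoGroup G)) : Prop extends IsGenCentralExt ι q where
  lie : 𝒢.IsLie
  lie_ι : ι.IsLie
  lie_q : q.IsLie
  /-- The inverse of `ι` on its image, near the unit, is the restriction of a smooth map that is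
  defined on an open neighbourhood of the unit. -/
  embedding_ι : ∃ (N : Set C₁) (r : C₁ → A × Z), IsOpen N ∧ 𝒢.idm 𝒢.one ∈ N ∧
    SmoothOnSet r N ∧ ∀ a, ι.mor a ∈ N → r (ι.mor a) = a
  section_q : ∃ (U : Set G) (σ : G → C₀), IsOpen U ∧ 1 ∈ U ∧ SmoothOnSet σ U ∧
    σ 1 = 𝒢.one ∧ ∀ u ∈ U, q.obj (σ u) = u

/-!
# The central extension of Lie algebras of a smooth generalised central extension

The kernel of `q` on morphisms near `id 𝟙` consists of identities: a morphism in it is `ι (a, z)`,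
where `a` depends continuously on it because `ι` has a smooth local inverse, so `a = 0` as `A` is
discrete (`IsSmoothGenCentralExt.exists_retraction`).  Hence every morphism `f` near `id 𝟙`
satisfies `f ⊗ inv (id (src f)) = id 𝟙` and `tgt f ⊗ inv (src f) = 𝟙`.  Differentiating these
identities at the unit gives `d id ∘ d src = 1` and `d tgt = d src`.  It does not follow
that `f` is itself an identity, since the model spaces have no inverse function theorem; so the
object multiplication is not claimed to be associative near the unit.

Applied to the associator, the second identity says `(x (y z)) ((x y) z)⁻¹ = 𝟙` for objects near the
unit.  This weak form of associativity suffices for the Jacobi identity.  The products `(x y) z` and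
`x (y z)` have the same derivatives of order at most two at the unit because the unit is strict, and
the map `(s, t) ↦ s t⁻¹` has the identity as its partial differential in `s`; so the trilinear third
derivatives of the two products agree too (`IsWeaklyAssocMul.derivAlong_assoc`).  On the other hand
these are `S (x, y, z) + B (B (x, y), z)` and `T (x, y, z) + B (x, B (y, z))`, where `B` is the mixed
second derivative of the multiplication, `S` is symmetric in `x, y`, and `T` is symmetric in `y, z`
(`IsLocalUnitalMul.derivAlong_mul_mul`).  Antisymmetrizing gives the Jacobi identity for the
commutator of `B`, which is the Lie bracket, the Taylor monomial of the multiplication being `B`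
(`IsLocalUnitalMul.dirDeriv₂_eq`).

The remaining assertions are first and second order derivatives of identities near the unit: `q` is
multiplicative on objects, `ι z ⊗ x = x ⊗ ι z`, `q (σ g) = g`, the local inverse of `ι` composed with
`ι` is the identity, and `x ⊗ inv (σ (q x))` lies in the image of `ι`, which gives exactness.

The calculus needed is developed for maps between locally convex spaces.  It rests on a mean value
theorem (`diffQuot_mem_of_convex`, from the Hahn–Banach theorem), which shows that differential
quotients converge locally uniformly in base point and direction
(`IsCDiffOn.tendsto_diffQuot_prod`); the chain rule, linearity of the differential and symmetry of
second derivatives follow.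
-/

set_option linter.unusedSectionVars false

/-! ### Differential calculus: mean values and the chain rule -/

section MeanValue

variable {E F : Type u}
  [AddCommGroup E] [Module ℝ E] [TopologicalSpace E]
  [AddCommGroup F] [Module ℝ F] [TopologicalSpace F]

/-- The differential quotient along a segment lies in every closed convex set that contains the
directional derivatives along that segment. -/
theorem diffQuot_mem_of_convex [IsTopologicalAddGroup F] [ContinuousSMul ℝ F]
    [LocallyConvexSpace ℝ F] {f : E → F} {x w : E} {h : ℝ} (hh : h ≠ 0)
    {K : Set F} (hK : Convex ℝ K) (hKc : IsClosed K) (d : ℝ → F)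
    (hd : ∀ c : ℝ, |c| ≤ |h| → Tendsto (diffQuot f (x + c • w) w) (𝓝[≠] (0 : ℝ)) (𝓝 (d c)))
    (hdK : ∀ c : ℝ, |c| ≤ |h| → d c ∈ K) : diffQuot f x w h ∈ K := by
  by_contra hn
  -- separate the quotient from `K` by a functional; the classical mean value theorem applies to it
  obtain ⟨l, m, hl, hm⟩ := geometric_hahn_banach_closed_point hK hKc hn
  have hderiv : ∀ s ∈ Icc (0 : ℝ) 1,
      HasDerivAt (fun s : ℝ => l (f (x + (s * h) • w))) (h * l (d (s * h))) s := by
    intro s hs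
    have hsh : |s * h| ≤ |h| := by
      rw [abs_mul, abs_of_nonneg hs.1]
      exact mul_le_of_le_one_left (abs_nonneg h) hs.2
    have h1 : HasDerivAt (fun c : ℝ => l (f (x + c • w))) (l (d (s * h))) (s * h) := by
      rw [hasDerivAt_iff_tendsto_slope_zero]
      refine ((l.continuous.tendsto _).comp (hd _ hsh)).congr fun t => ?_
      simp only [Function.comp, diffQuot, map_smul, map_sub, add_smul, add_assoc]
    have h2 : HasDerivAt (fun s : ℝ => s * h) h s := by
      simpa using (hasDerivAt_id s).mul_const h
    exact h1.scomp s h2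
  obtain ⟨c, hc, hc'⟩ := exists_hasDerivAt_eq_slope
    (fun s : ℝ => l (f (x + (s * h) • w))) (fun s => h * l (d (s * h))) zero_lt_one
    (fun s hs => (hderiv s hs).continuousAt.continuousWithinAt)
    (fun s hs => hderiv s ⟨hs.1.le, hs.2.le⟩)
  have hch : |c * h| ≤ |h| := by
    rw [abs_mul, abs_of_nonneg hc.1.le]
    exact mul_le_of_le_one_left (abs_nonneg h) hc.2.le
  have h3 : l (diffQuot f x w h) = l (d (c * h)) := by
    simp only [diffQuot, map_smul, map_sub, smul_eq_mul]
    simp only [one_mul, zero_mul, zero_smul, add_zero, sub_zero, div_one] at hc'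
    rw [← hc', inv_mul_cancel_left₀ hh]
  have := hl _ (hdK _ hch)
  rw [← h3] at this
  exact lt_asymm this hm

/-- In a locally convex space the closed convex neighbourhoods of a point form a basis. -/
theorem exists_closed_convex_subset [IsTopologicalAddGroup F] [ContinuousSMul ℝ F]
    [LocallyConvexSpace ℝ F] {y : F} {K : Set F} (hK : K ∈ 𝓝 y) :
    ∃ K' ∈ 𝓝 y, Convex ℝ K' ∧ IsClosed K' ∧ K' ⊆ K := by
  obtain ⟨C, hC, hCc, hCK⟩ := exists_mem_nhds_isClosed_subset hK
  obtain ⟨V, ⟨hV, hVc⟩, hVC⟩ := (LocallyConvexSpace.convex_basis (𝕜 := ℝ) y).mem_iff.1 hC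
  exact ⟨closure V, mem_of_superset hV subset_closure, hVc.closure, isClosed_closure,
    (closure_minimal hVC hCc).trans hCK⟩

end MeanValue

section Calculus

variable {D E F : Type u}
  [AddCommGroup D] [Module ℝ D] [TopologicalSpace D] [IsTopologicalAddGroup D]
  [ContinuousSMul ℝ D] [LocallyConvexSpace ℝ D] [T2Space D]
  [AddCommGroup E] [Module ℝ E] [TopologicalSpace E] [IsTopologicalAddGroup E]
  [ContinuousSMul ℝ E] [LocallyConvexSpace ℝ E] [T2Space E]
  [AddCommGroup F] [Module ℝ F] [TopologicalSpace F] [IsTopologicalAddGroup F]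
  [ContinuousSMul ℝ F] [LocallyConvexSpace ℝ F] [T2Space F]

theorem IsCDiffOn.continuousOn {n : ℕ} {f : E → F} {U : Set E} (hf : IsCDiffOn n f U) :
    ContinuousOn f U := by
  cases n with
  | zero => exact hf
  | succ n => exact hf.1

theorem IsCDiffOn.tendsto_diffQuot {n : ℕ} {f : E → F} {U : Set E} (hf : IsCDiffOn (n + 1) f U)
    {x : E} (hx : x ∈ U) (w : E) :
    Tendsto (diffQuot f x w) (𝓝[≠] (0 : ℝ)) (𝓝 (dirDeriv f x w)) :=
  tendsto_nhds_limUnder (hf.2.1 x hx w)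

theorem tendsto_line (x w : E) : Tendsto (fun h : ℝ => x + h • w) (𝓝 0) (𝓝 x) := by
  have : Continuous (fun h : ℝ => x + h • w) := by fun_prop
  simpa using this.tendsto 0

theorem dirDeriv_congr_line {f g : E → F} {x w : E}
    (h : ∀ᶠ t : ℝ in 𝓝 0, f (x + t • w) = g (x + t • w)) : dirDeriv f x w = dirDeriv g x w := by
  have h0 : f x = g x := by simpa using h.self_of_nhds
  have : diffQuot f x w =ᶠ[𝓝[≠] (0 : ℝ)] diffQuot g x w := by
    filter_upwards [nhdsWithin_le_nhds h] with t ht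
    simp only [diffQuot, ht, h0]
  unfold dirDeriv limUnder
  rw [Filter.map_congr this]

theorem dirDeriv_congr {f g : E → F} {x : E} (h : f =ᶠ[𝓝 x] g) (w : E) :
    dirDeriv f x w = dirDeriv g x w :=
  dirDeriv_congr_line ((tendsto_line x w).eventually h)

theorem IsCDiffOn.congr_mono {n : ℕ} : ∀ {E : Type u} [AddCommGroup E] [Module ℝ E]
    [TopologicalSpace E] [IsTopologicalAddGroup E] [ContinuousSMul ℝ E]
    [LocallyConvexSpace ℝ E] [T2Space E] {f g : E → F}
    {U V : Set E} (_ : IsCDiffOn n f U) (_ : IsOpen V) (_ : V ⊆ U) (_ : EqOn g f V),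
    IsCDiffOn n g V := by
  induction n with
  | zero =>
    intro E _ _ _ _ _ _ _ f g U V hf _ hVU hg
    exact (ContinuousOn.mono hf hVU).congr hg
  | succ n ih =>
    intro E _ _ _ _ _ _ _ f g U V hf hV hVU hg
    have hev : ∀ x ∈ V, g =ᶠ[𝓝 x] f := fun x hx => by
      filter_upwards [hV.mem_nhds hx] with y hy using hg hy
    refine ⟨(hf.1.mono hVU).congr hg, fun x hx w => ?_, ?_⟩
    · obtain ⟨y, hy⟩ := hf.2.1 x (hVU hx) w
      refine ⟨y, hy.congr' ?_⟩
      filter_upwards [nhdsWithin_le_nhds ((tendsto_line x w).eventually (hev x hx))] with t ht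
      simp only [diffQuot, ht, hg hx]
    · exact ih hf.2.2 (hV.prod isOpen_univ) (prod_mono hVU subset_rfl)
        fun p hp => dirDeriv_congr (hev p.1 hp.1) p.2

theorem IsCDiffOn.of_succ {n : ℕ} : ∀ {E : Type u} [AddCommGroup E] [Module ℝ E]
    [TopologicalSpace E] {f : E → F} {U : Set E} (_ : IsCDiffOn (n + 1) f U),
    IsCDiffOn n f U := by
  induction n with
  | zero => intro E _ _ _ f U hf; exact hf.1
  | succ n ih => intro E _ _ _ f U hf; exact ⟨hf.1, hf.2.1, ih hf.2.2⟩

theorem IsCDiffOn.one_of_succ {n : ℕ} {f : E → F} {U : Set E} (hf : IsCDiffOn (n + 1) f U) :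
    IsCDiffOn 1 f U := by
  induction n with
  | zero => exact hf
  | succ n ih => exact ih hf.of_succ

theorem dirDeriv_clm (L : E →L[ℝ] F) (x w : E) : dirDeriv L x w = L w := by
  refine Tendsto.limUnder_eq (tendsto_const_nhds.congr' ?_)
  filter_upwards [self_mem_nhdsWithin] with h hh
  have : h ≠ 0 := hh
  simp [diffQuot, this]

theorem isCDiffOn_clm {n : ℕ} : ∀ {E : Type u} [AddCommGroup E] [Module ℝ E]
    [TopologicalSpace E] [IsTopologicalAddGroup E] [ContinuousSMul ℝ E]
    [LocallyConvexSpace ℝ E] [T2Space E] (L : E →L[ℝ] F),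
    IsCDiffOn n L univ := by
  induction n with
  | zero => intro E _ _ _ _ _ _ _ L; exact L.continuous.continuousOn
  | succ n ih =>
    intro E _ _ _ _ _ _ _ L
    refine ⟨L.continuous.continuousOn, fun x _ w => ⟨L w, tendsto_const_nhds.congr' ?_⟩, ?_⟩
    · filter_upwards [self_mem_nhdsWithin] with h hh
      have : h ≠ 0 := hh
      simp [diffQuot, this]
    · exact (ih (L.comp (ContinuousLinearMap.snd ℝ E E))).congr_mono
        (isOpen_univ.prod isOpen_univ) (subset_univ _) fun p _ => dirDeriv_clm L p.1 p.2

theorem dirDeriv_const (c : F) (x w : E) : dirDeriv (fun _ : E => c) x w = 0 := by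
  refine Tendsto.limUnder_eq (tendsto_const_nhds.congr fun h => ?_)
  simp [diffQuot]

theorem isCDiffOn_const {n : ℕ} : ∀ {E : Type u} [AddCommGroup E] [Module ℝ E]
    [TopologicalSpace E] [IsTopologicalAddGroup E] [ContinuousSMul ℝ E]
    [LocallyConvexSpace ℝ E] [T2Space E] (c : F),
    IsCDiffOn n (fun _ : E => c) univ := by
  cases n with
  | zero => intro E _ _ _ _ _ _ _ c; exact continuousOn_const
  | succ n =>
    intro E _ _ _ _ _ _ _ c
    refine ⟨continuousOn_const, fun x _ w => ⟨0, tendsto_const_nhds.congr fun h => ?_⟩, ?_⟩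
    · simp [diffQuot]
    · exact (isCDiffOn_clm (0 : (E × E) →L[ℝ] F)).congr_mono
        (isOpen_univ.prod isOpen_univ) (subset_univ _) fun p _ => dirDeriv_const c p.1 p.2

theorem IsCDiffOn.comp_clm {n : ℕ} : ∀ {D E : Type u}
    [AddCommGroup D] [Module ℝ D] [TopologicalSpace D]
    [AddCommGroup E] [Module ℝ E] [TopologicalSpace E]
    {f : E → F} {U : Set E} (_ : IsCDiffOn n f U) (L : D →L[ℝ] E),
    IsCDiffOn n (fun x => f (L x)) (L ⁻¹' U) := by
  induction n with
  | zero =>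
    intro D E _ _ _ _ _ _ f U hf L
    exact ContinuousOn.comp hf L.continuous.continuousOn fun x hx => hx
  | succ n ih =>
    intro D E _ _ _ _ _ _ f U hf L
    have hq : ∀ x w, diffQuot (fun x => f (L x)) x w = diffQuot f (L x) (L w) := fun x w => by
      funext h; simp [diffQuot]
    refine ⟨hf.1.comp L.continuous.continuousOn fun x hx => hx, fun x hx w => ?_, ?_⟩
    · rw [hq]; exact hf.2.1 (L x) hx (L w)
    · have h := ih hf.2.2 ((L.comp (ContinuousLinearMap.fst ℝ D D)).prod
        (L.comp (ContinuousLinearMap.snd ℝ D D)))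
      have h2 : (fun p : D × D => dirDeriv (fun x => f (L x)) p.1 p.2) =
          fun p => dirDeriv f (L p.1) (L p.2) := by
        funext p; simp only [dirDeriv, hq]
      rw [h2]
      exact h

/-- For a `C¹` map the differential quotients converge locally uniformly in base point and
direction; this is where local convexity of the target enters. -/
theorem IsCDiffOn.tendsto_diffQuot_prod {f : E → F} {U : Set E}
    (hf : IsCDiffOn 1 f U) (hU : IsOpen U) {x : E} (hx : x ∈ U) (w : E) :
    Tendsto (fun p : (E × E) × ℝ => diffQuot f p.1.1 p.1.2 p.2) (𝓝 (x, w) ×ˢ 𝓝[≠] (0 : ℝ))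
      (𝓝 (dirDeriv f x w)) := by
  intro K hK
  obtain ⟨K', hK', hconv, hcl, hsub⟩ := exists_closed_convex_subset hK
  have hcont : ContinuousAt (fun p : E × E => dirDeriv f p.1 p.2) (x, w) :=
    (show ContinuousOn _ _ from hf.2.2).continuousAt
      ((hU.prod isOpen_univ).mem_nhds ⟨hx, mem_univ w⟩)
  -- the derivatives along all short segments with nearby data lie in a closed convex set
  have hline : Tendsto (fun p : (E × E) × ℝ => (p.1.1 + p.2 • p.1.2, p.1.2))
      (𝓝 (x, w) ×ˢ 𝓝 (0 : ℝ)) (𝓝 (x, w)) := by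
    have : Continuous (fun p : (E × E) × ℝ => (p.1.1 + p.2 • p.1.2, p.1.2)) := by fun_prop
    have := this.tendsto ((x, w), 0)
    rwa [nhds_prod_eq, show ((x + (0 : ℝ) • w, w) : E × E) = (x, w) by simp] at this
  have hUw : U ×ˢ univ ∈ 𝓝 (x, w) := (hU.prod isOpen_univ).mem_nhds ⟨hx, mem_univ w⟩
  have hev := hline.eventually ((hcont.eventually hK').and hUw)
  obtain ⟨P, hP, Q, hQ, hPQ⟩ := eventually_prod_iff.1 hev
  obtain ⟨ε, hε, hball⟩ := Metric.mem_nhds_iff.1 hQ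
  refine mem_map.2 (mem_of_superset (prod_mem_prod hP (inter_mem
    (nhdsWithin_le_nhds (Metric.ball_mem_nhds (0 : ℝ) hε)) self_mem_nhdsWithin)) ?_)
  rintro ⟨⟨y, w'⟩, h⟩ ⟨hy, hh, hh0⟩
  have hc : ∀ c : ℝ, |c| ≤ |h| → Q c := fun c hc => hball (by
    rw [mem_ball_zero_iff, Real.norm_eq_abs] at hh ⊢
    exact hc.trans_lt hh)
  refine hsub (diffQuot_mem_of_convex hh0 hconv hcl (fun c => dirDeriv f (y + c • w') w')
    (fun c hch => hf.tendsto_diffQuot (hPQ hy (hc c hch)).2.1 w')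
    fun c hch => (hPQ hy (hc c hch)).1)

/-- The chain rule, at the level of differential quotients. -/
theorem IsCDiffOn.tendsto_diffQuot_comp {g : E → F} {V : Set E}
    (hg : IsCDiffOn 1 g V) (hV : IsOpen V) {f : D → E} {x w : D} {y : E} (hx : f x ∈ V)
    (hf : Tendsto (diffQuot f x w) (𝓝[≠] (0 : ℝ)) (𝓝 y)) :
    Tendsto (diffQuot (fun z => g (f z)) x w) (𝓝[≠] (0 : ℝ)) (𝓝 (dirDeriv g (f x) y)) := by
  have h1 : Tendsto (fun h : ℝ => ((f x, diffQuot f x w h), h)) (𝓝[≠] 0)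
      (𝓝 (f x, y) ×ˢ 𝓝[≠] (0 : ℝ)) := by
    rw [nhds_prod_eq]
    exact (tendsto_const_nhds.prodMk hf).prodMk tendsto_id
  refine ((hg.tendsto_diffQuot_prod hV hx y).comp h1).congr' ?_
  filter_upwards [self_mem_nhdsWithin] with h hh
  have : h ≠ 0 := hh
  simp [diffQuot, smul_smul, this]

theorem IsCDiffOn.prodMk {n : ℕ} {f : D → E} {g : D → F} {U : Set D}
    (hU : IsOpen U) (hf : IsCDiffOn n f U) (hg : IsCDiffOn n g U) :
    IsCDiffOn n (fun x => (f x, g x)) U :=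
  isCDiffOn_prodMap_comp n f g U U
    ((ContinuousLinearMap.id ℝ D).prod (ContinuousLinearMap.id ℝ D)) _ _ hU
    (by ext; simp) (fun _ _ => rfl) hf hg

/-- Composites of `Cⁿ` maps are `Cⁿ`, since `d(g ∘ f) (x, w) = dg (f x, df (x, w))`. -/
theorem IsCDiffOn.comp {n : ℕ} : ∀ {D E : Type u}
    [AddCommGroup D] [Module ℝ D] [TopologicalSpace D] [IsTopologicalAddGroup D]
    [ContinuousSMul ℝ D] [LocallyConvexSpace ℝ D] [T2Space D]
    [AddCommGroup E] [Module ℝ E] [TopologicalSpace E] [IsTopologicalAddGroup E]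
    [ContinuousSMul ℝ E] [LocallyConvexSpace ℝ E] [T2Space E]
    {g : E → F} {V : Set E} {f : D → E} {U : Set D}
    (_ : IsCDiffOn n g V) (_ : IsCDiffOn n f U) (_ : IsOpen V) (_ : IsOpen U)
    (_ : MapsTo f U V), IsCDiffOn n (fun x => g (f x)) U := by
  induction n with
  | zero => intro D E _ _ _ _ _ _ _ _ _ _ _ _ _ _ g V f U hg hf _ _ hm; exact ContinuousOn.comp hg hf hm
  | succ n ih =>
    intro D E _ _ _ _ _ _ _ _ _ _ _ _ _ _ g V f U hg hf hV hU hm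
    have hlim := fun x (hx : x ∈ U) w =>
      hg.one_of_succ.tendsto_diffQuot_comp hV (hm hx) (hf.tendsto_diffQuot hx w)
    refine ⟨hg.1.comp hf.1 hm, fun x hx w => ⟨_, hlim x hx w⟩, ?_⟩
    have h1 : IsCDiffOn n (fun p : D × D => f p.1) (U ×ˢ univ) := by
      have := hf.of_succ.comp_clm (ContinuousLinearMap.fst ℝ D D)
      exact this.congr_mono (hU.prod isOpen_univ) (fun p hp => hp.1) fun _ _ => rfl
    exact (ih hg.2.2 (h1.prodMk (hU.prod isOpen_univ) hf.2.2) (hV.prod isOpen_univ)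
      (hU.prod isOpen_univ) fun p hp => ⟨hm hp.1, mem_univ _⟩).congr_mono
      (hU.prod isOpen_univ) subset_rfl fun p hp => (hlim p.1 hp.1 p.2).limUnder_eq

end Calculus

/-! ### Germs of smooth maps between locally convex spaces -/

section Germs

variable {D E F : Type u}
  [AddCommGroup D] [Module ℝ D] [TopologicalSpace D] [IsTopologicalAddGroup D]
  [ContinuousSMul ℝ D] [LocallyConvexSpace ℝ D] [T2Space D]
  [AddCommGroup E] [Module ℝ E] [TopologicalSpace E] [IsTopologicalAddGroup E]
  [ContinuousSMul ℝ E] [LocallyConvexSpace ℝ E] [T2Space E]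
  [AddCommGroup F] [Module ℝ F] [TopologicalSpace F] [IsTopologicalAddGroup F]
  [ContinuousSMul ℝ F] [LocallyConvexSpace ℝ F] [T2Space F]

/-- `f` is smooth on some open neighbourhood of `x`. -/
def IsCInftyAt (f : E → F) (x : E) : Prop := ∃ U, IsOpen U ∧ x ∈ U ∧ IsCInftyOn f U

/-- The derivative of `f` in the fixed direction `w`, as a function of the base point. -/
noncomputable def derivAlong (w : E) (f : E → F) : E → F := fun x => dirDeriv f x w

/-- The tangent map of `f` without its base point component, as a function of base point and
direction. -/
noncomputable def tangentPart (f : E → F) : E × E → F := fun p => dirDeriv f p.1 p.2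

theorem IsCInftyAt.eventually {f : E → F} {x : E} (hf : IsCInftyAt f x) :
    ∀ᶠ y in 𝓝 x, IsCInftyAt f y := by
  obtain ⟨U, hU, hx, h⟩ := hf
  filter_upwards [hU.mem_nhds hx] with y hy using ⟨U, hU, hy, h⟩

theorem IsCInftyAt.continuousAt {f : E → F} {x : E} (hf : IsCInftyAt f x) : ContinuousAt f x := by
  obtain ⟨U, hU, hx, h⟩ := hf
  exact (h 0).continuousOn.continuousAt (hU.mem_nhds hx)

theorem IsCInftyAt.congr {f g : E → F} {x : E} (hf : IsCInftyAt f x) (h : g =ᶠ[𝓝 x] f) :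
    IsCInftyAt g x := by
  obtain ⟨U, hU, hx, hfU⟩ := hf
  obtain ⟨V, hV, hVo, hxV⟩ := eventually_nhds_iff.1 h
  exact ⟨U ∩ V, hU.inter hVo, ⟨hx, hxV⟩, fun n =>
    (hfU n).congr_mono (hU.inter hVo) inter_subset_left fun y hy => hV y hy.2⟩

theorem isCInftyAt_clm (L : E →L[ℝ] F) (x : E) : IsCInftyAt L x :=
  ⟨univ, isOpen_univ, mem_univ x, fun _ => isCDiffOn_clm L⟩

theorem isCInftyAt_id (x : E) : IsCInftyAt (fun y : E => y) x :=
  isCInftyAt_clm (ContinuousLinearMap.id ℝ E) x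

theorem isCInftyAt_fst (p : E × F) : IsCInftyAt (fun y : E × F => y.1) p :=
  isCInftyAt_clm (ContinuousLinearMap.fst ℝ E F) p

theorem isCInftyAt_snd (p : E × F) : IsCInftyAt (fun y : E × F => y.2) p :=
  isCInftyAt_clm (ContinuousLinearMap.snd ℝ E F) p

theorem isCInftyAt_const (c : F) (x : E) : IsCInftyAt (fun _ : E => c) x :=
  ⟨univ, isOpen_univ, mem_univ x, fun _ => isCDiffOn_const c⟩

theorem IsCInftyAt.prodMk {f : D → E} {g : D → F} {x : D} (hf : IsCInftyAt f x)
    (hg : IsCInftyAt g x) : IsCInftyAt (fun y => (f y, g y)) x := by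
  obtain ⟨U, hU, hx, hfU⟩ := hf
  obtain ⟨V, hV, hxV, hgV⟩ := hg
  refine ⟨U ∩ V, hU.inter hV, ⟨hx, hxV⟩, fun n => IsCDiffOn.prodMk (hU.inter hV) ?_ ?_⟩
  · exact (hfU n).congr_mono (hU.inter hV) inter_subset_left fun _ _ => rfl
  · exact (hgV n).congr_mono (hU.inter hV) inter_subset_right fun _ _ => rfl

theorem IsCInftyAt.comp {g : E → F} {f : D → E} {x : D} {z : E} (hg : IsCInftyAt g z)
    (hf : IsCInftyAt f x) (hz : f x = z := by rfl) : IsCInftyAt (fun y => g (f y)) x := by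
  subst hz
  obtain ⟨U, hU, hx, hfU⟩ := hf
  obtain ⟨V, hV, hxV, hgV⟩ := hg
  have hW : IsOpen (U ∩ f ⁻¹' V) := (hfU 0).continuousOn.isOpen_inter_preimage hU hV
  refine ⟨U ∩ f ⁻¹' V, hW, ⟨hx, hxV⟩, fun n => (hgV n).comp ?_ hV hW fun y hy => hy.2⟩
  exact (hfU n).congr_mono hW inter_subset_left fun _ _ => rfl

theorem IsCInftyAt.tendsto_diffQuot {f : E → F} {x : E} (hf : IsCInftyAt f x) (w : E) :
    Tendsto (diffQuot f x w) (𝓝[≠] (0 : ℝ)) (𝓝 (dirDeriv f x w)) := by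
  obtain ⟨U, hU, hx, hfU⟩ := hf
  exact (hfU 1).tendsto_diffQuot hx w

theorem IsCInftyAt.tendsto_diffQuot_prod {f : E → F} {x : E} (hf : IsCInftyAt f x) (w : E) :
    Tendsto (fun p : (E × E) × ℝ => diffQuot f p.1.1 p.1.2 p.2) (𝓝 (x, w) ×ˢ 𝓝[≠] (0 : ℝ))
      (𝓝 (dirDeriv f x w)) := by
  obtain ⟨U, hU, hx, hfU⟩ := hf
  exact (hfU 1).tendsto_diffQuot_prod hU hx w

theorem IsCInftyAt.tangentPart {f : E → F} {x : E} (hf : IsCInftyAt f x) (w : E) :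
    IsCInftyAt (tangentPart f) (x, w) := by
  obtain ⟨U, hU, hx, hfU⟩ := hf
  exact ⟨U ×ˢ univ, hU.prod isOpen_univ, ⟨hx, mem_univ w⟩, fun n => (hfU (n + 1)).2.2⟩

theorem IsCInftyAt.derivAlong {f : E → F} {x : E} (hf : IsCInftyAt f x) (w : E) :
    IsCInftyAt (derivAlong w f) x := by
  have := (hf.tangentPart w).comp ((isCInftyAt_id x).prodMk (isCInftyAt_const w x))
  exact this

theorem IsCInftyAt.continuous_dirDeriv {f : E → F} {x : E} (hf : IsCInftyAt f x) :
    Continuous (dirDeriv f x) := by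
  refine continuous_iff_continuousAt.2 fun w => ?_
  exact ((hf.tangentPart w).comp ((isCInftyAt_const x w).prodMk (isCInftyAt_id w))).continuousAt

theorem dirDeriv_comp {g : E → F} {f : D → E} {x : D} {z : E} (hg : IsCInftyAt g z)
    (hf : IsCInftyAt f x) (w : D) (hz : f x = z := by rfl) :
    dirDeriv (fun y => g (f y)) x w = dirDeriv g z (dirDeriv f x w) := by
  subst hz
  obtain ⟨V, hV, hxV, hgV⟩ := hg
  exact ((hgV 1).tendsto_diffQuot_comp hV hxV (hf.tendsto_diffQuot w)).limUnder_eq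

theorem dirDeriv_id (x w : E) : dirDeriv (fun y : E => y) x w = w :=
  dirDeriv_clm (ContinuousLinearMap.id ℝ E) x w

theorem dirDeriv_prodMk {f : D → E} {g : D → F} {x : D} (hf : IsCInftyAt f x)
    (hg : IsCInftyAt g x) (w : D) :
    dirDeriv (fun y => (f y, g y)) x w = (dirDeriv f x w, dirDeriv g x w) := by
  refine Tendsto.limUnder_eq
    (((hf.tendsto_diffQuot w).prodMk_nhds (hg.tendsto_diffQuot w)).congr fun h => ?_)
  ext <;> simp [diffQuot]

theorem dirDeriv_smul {f : E → F} {x : E} (hf : IsCInftyAt f x) (c : ℝ) (w : E) :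
    dirDeriv f x (c • w) = c • dirDeriv f x w := by
  rcases eq_or_ne c 0 with rfl | hc
  · simp only [zero_smul]
    exact (tendsto_const_nhds.congr fun h => by simp [diffQuot]).limUnder_eq
  · have h1 : Tendsto (fun h : ℝ => h * c) (𝓝[≠] 0) (𝓝[≠] 0) := by
      refine tendsto_nhdsWithin_iff.2 ⟨?_, ?_⟩
      · have : Tendsto (fun h : ℝ => h * c) (𝓝 0) (𝓝 0) := by
          simpa using (continuous_mul_const c).tendsto (0 : ℝ)
        exact this.mono_left nhdsWithin_le_nhds
      · filter_upwards [self_mem_nhdsWithin] with h hh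
        exact mul_ne_zero hh hc
    refine Tendsto.limUnder_eq ((((hf.tendsto_diffQuot w).comp h1).const_smul c).congr fun h => ?_)
    simp only [Function.comp, diffQuot, smul_smul, mul_inv]
    congr 1
    field_simp

theorem dirDeriv_add {f : E → F} {x : E} (hf : IsCInftyAt f x) (v w : E) :
    dirDeriv f x (v + w) = dirDeriv f x v + dirDeriv f x w := by
  have h1 : Tendsto (fun h : ℝ => ((x + h • v, w), h)) (𝓝[≠] 0)
      (𝓝 (x, w) ×ˢ 𝓝[≠] (0 : ℝ)) := by
    rw [nhds_prod_eq]
    exact (((tendsto_line x v).mono_left nhdsWithin_le_nhds).prodMk tendsto_const_nhds).prodMk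
      tendsto_id
  refine Tendsto.limUnder_eq
    (((hf.tendsto_diffQuot v).add ((hf.tendsto_diffQuot_prod w).comp h1)).congr fun h => ?_)
  simp only [Function.comp, diffQuot, ← smul_add, add_assoc]
  congr 1
  abel

theorem dirDeriv_zero {f : E → F} {x : E} (hf : IsCInftyAt f x) : dirDeriv f x 0 = 0 := by
  simpa using dirDeriv_smul hf 0 0

theorem dirDeriv_sub {f : E → F} {x : E} (hf : IsCInftyAt f x) (v w : E) :
    dirDeriv f x (v - w) = dirDeriv f x v - dirDeriv f x w := by
  have := dirDeriv_add hf (v - w) w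
  rw [sub_add_cancel] at this
  rw [this, add_sub_cancel_right]

theorem dirDeriv_prod_split {f : D × E → F} {p : D × E} (hf : IsCInftyAt f p) (v : D) (w : E) :
    dirDeriv f p (v, w) = dirDeriv f p (v, 0) + dirDeriv f p (0, w) := by
  rw [← dirDeriv_add hf]; simp

/-- The derivative of a sum of functions. -/
theorem dirDeriv_fun_add {f g : E → F} {x : E} (hf : IsCInftyAt f x) (hg : IsCInftyAt g x) (w : E) :
    dirDeriv (fun y => f y + g y) x w = dirDeriv f x w + dirDeriv g x w := by
  refine Tendsto.limUnder_eq
    (((hf.tendsto_diffQuot w).add (hg.tendsto_diffQuot w)).congr fun h => ?_)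
  simp only [diffQuot, ← smul_add]
  congr 1
  abel

theorem derivAlong_congr {f g : E → F} {x : E} (h : f =ᶠ[𝓝 x] g) (w : E) :
    derivAlong w f =ᶠ[𝓝 x] derivAlong w g := by
  filter_upwards [eventually_eventually_nhds.2 h] with y hy using dirDeriv_congr hy w

/-- Symmetry of second derivatives: both mixed derivatives are the limit of the same symmetric
second order difference quotient. -/
theorem derivAlong_comm {f : E → F} {x : E} (hf : IsCInftyAt f x) (a b : E) :
    derivAlong a (derivAlong b f) x = derivAlong b (derivAlong a f) x := by
  have key : ∀ a b : E, Tendsto (fun h : ℝ => diffQuot (fun y => diffQuot f y b h) x a h)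
      (𝓝[≠] 0) (𝓝 (derivAlong b (derivAlong a f) x)) := by
    intro a b K hK
    obtain ⟨K', hK', hconv, hcl, hsub⟩ := exists_closed_convex_subset hK
    have h0 : Tendsto (fun p : ℝ × ℝ => ((x + p.1 • a, b), p.2)) (𝓝 0 ×ˢ 𝓝[≠] 0)
        (𝓝 (x, b) ×ˢ 𝓝[≠] (0 : ℝ)) := by
      rw [nhds_prod_eq]
      exact (((tendsto_line x a).comp tendsto_fst).prodMk tendsto_const_nhds).prodMk tendsto_snd
    have h1 := (((hf.derivAlong a).tendsto_diffQuot_prod b).comp h0).eventually hK'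
    have h2 : Tendsto (fun p : ℝ × ℝ => x + p.1 • a) (𝓝 0 ×ˢ 𝓝[≠] 0) (𝓝 x) :=
      (tendsto_line x a).comp tendsto_fst
    have h3 : Tendsto (fun p : ℝ × ℝ => x + p.1 • a + p.2 • b) (𝓝 0 ×ˢ 𝓝[≠] 0) (𝓝 x) := by
      have : Continuous (fun p : ℝ × ℝ => x + p.1 • a + p.2 • b) := by fun_prop
      have := this.tendsto (0, 0)
      rw [nhds_prod_eq] at this
      simp only [zero_smul, add_zero] at this
      exact this.mono_left (prod_mono_right _ nhdsWithin_le_nhds)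
    have hev := (h1.and (h2.eventually hf.eventually)).and (h3.eventually hf.eventually)
    obtain ⟨P, hP, Q, hQ, hPQ⟩ := eventually_prod_iff.1 hev
    obtain ⟨ε, hε, hball⟩ := Metric.mem_nhds_iff.1 hP
    refine mem_map.2 (mem_of_superset (inter_mem (inter_mem hQ self_mem_nhdsWithin)
      (nhdsWithin_le_nhds (Metric.ball_mem_nhds (0 : ℝ) hε))) ?_)
    rintro h ⟨⟨hh, hh0⟩, hhε⟩
    have hc : ∀ c : ℝ, |c| ≤ |h| → P c := fun c hc => hball (by
      rw [mem_ball_zero_iff, Real.norm_eq_abs] at hhε ⊢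
      exact hc.trans_lt hhε)
    refine hsub (diffQuot_mem_of_convex hh0 hconv hcl
      (fun c => diffQuot (derivAlong a f) (x + c • a) b h) (fun c hch => ?_)
      fun c hch => (hPQ (hc c hch) hh).1.1)
    have hs := ((hPQ (hc c hch) hh).2.tendsto_diffQuot a).sub
      ((hPQ (hc c hch) hh).1.2.tendsto_diffQuot a)
    refine (hs.const_smul h⁻¹).congr fun t => ?_
    simp only [diffQuot, ← smul_sub, smul_comm t⁻¹ h⁻¹]
    congr 2
    rw [show x + c • a + h • b + t • a = x + c • a + t • a + h • b by abel]
    abel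
  refine tendsto_nhds_unique (key b a) ((key a b).congr fun h => ?_)
  simp only [diffQuot, ← smul_sub]
  rw [show x + h • b + h • a = x + h • a + h • b by abel]
  congr 2
  abel

theorem derivAlong_comm_eventually {f : E → F} {x : E} (hf : IsCInftyAt f x) (a b : E) :
    derivAlong a (derivAlong b f) =ᶠ[𝓝 x] derivAlong b (derivAlong a f) := by
  filter_upwards [hf.eventually] with y hy using derivAlong_comm hy a b

/-- The derivative of the tangent map: the derivative in the base point plus the tangent map
itself, since it is linear in the direction. -/
theorem dirDeriv_tangentPart {f : E → F} {x : E} (hf : IsCInftyAt f x) (v a w : E) :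
    dirDeriv (tangentPart f) (x, v) (a, w) = derivAlong a (derivAlong v f) x + dirDeriv f x w := by
  rw [dirDeriv_prod_split (hf.tangentPart v)]
  congr 1
  · have : diffQuot (tangentPart f) (x, v) (a, 0) = diffQuot (derivAlong v f) x a := by
      funext h; simp [diffQuot, tangentPart, derivAlong]
    rw [dirDeriv, this]; rfl
  · refine (tendsto_const_nhds.congr' ?_).limUnder_eq
    filter_upwards [self_mem_nhdsWithin] with h hh
    have hh : h ≠ 0 := hh
    simp only [diffQuot, tangentPart, Prod.smul_mk, smul_zero, Prod.mk_add_mk, add_zero]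
    rw [dirDeriv_add hf, add_sub_cancel_left, dirDeriv_smul hf, inv_smul_smul₀ hh]

theorem dirDeriv_tangentPart_zero {f : E → F} {p : E × E} (hf : IsCInftyAt f p.1) (w : E) :
    dirDeriv (tangentPart f) p (0, w) = dirDeriv f p.1 w := by
  have := dirDeriv_tangentPart hf p.2 0 w
  rwa [derivAlong, dirDeriv_zero (hf.derivAlong _), zero_add] at this

/-- The product rule for the derivative of `h` in a variable direction `k`. -/
theorem dirDeriv_dirDeriv_apply {h : E → F} {k : E → E} {x : E} (hh : IsCInftyAt h x)
    (hk : IsCInftyAt k x) (a : E) :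
    dirDeriv (fun y => dirDeriv h y (k y)) x a =
      derivAlong a (derivAlong (k x) h) x + dirDeriv h x (dirDeriv k x a) := by
  have := dirDeriv_comp (hh.tangentPart (k x)) ((isCInftyAt_id x).prodMk hk) a
  rw [dirDeriv_prodMk (isCInftyAt_id x) hk, dirDeriv_id, dirDeriv_tangentPart hh] at this
  exact this

theorem derivAlong_comp_eventually {g : E → F} {f : D → E} {x : D} {z : E}
    (hg : IsCInftyAt g z) (hf : IsCInftyAt f x) (w : D) (hz : f x = z := by rfl) :
    derivAlong w (fun y => g (f y)) =ᶠ[𝓝 x] fun y => tangentPart g (f y, derivAlong w f y) := by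
  subst hz
  filter_upwards [hf.eventually, hf.continuousAt.eventually hg.eventually] with y h1 h2
    using dirDeriv_comp h2 h1 w

/-- The third order chain rule, in terms of iterated tangent maps. -/
theorem derivAlong_comp₃ {g : E → F} {f : D → E} {x : D} (hg : IsCInftyAt g (f x))
    (hf : IsCInftyAt f x) (a b c : D) :
    derivAlong a (derivAlong b (derivAlong c (fun y => g (f y)))) x =
      dirDeriv (tangentPart (tangentPart g))
        ((f x, derivAlong c f x), (derivAlong b f x, derivAlong b (derivAlong c f) x))
        ((derivAlong a f x, derivAlong a (derivAlong c f) x),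
          (derivAlong a (derivAlong b f) x,
            derivAlong a (derivAlong b (derivAlong c f)) x)) := by
  have hc := hf.derivAlong c
  have hfc := hf.prodMk hc
  have hg1 := hg.tangentPart (derivAlong c f x)
  have e1 := derivAlong_congr (derivAlong_comp_eventually hg hf c) b
  have e2 := e1.trans (derivAlong_comp_eventually hg1 hfc b)
  have e3 : derivAlong b (fun y => (f y, derivAlong c f y)) =ᶠ[𝓝 x]
      fun y => (derivAlong b f y, derivAlong b (derivAlong c f) y) := by
    filter_upwards [hf.eventually, hc.eventually] with y h1 h2 using dirDeriv_prodMk h1 h2 b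
  have hfcb := hfc.prodMk ((hf.derivAlong b).prodMk (hc.derivAlong b))
  have e4 : derivAlong b (derivAlong c (fun y => g (f y))) =ᶠ[𝓝 x] fun y =>
      tangentPart (tangentPart g) ((f y, derivAlong c f y),
        (derivAlong b f y, derivAlong b (derivAlong c f) y)) := by
    filter_upwards [e2, e3] with y h2 h3
    rw [h2, h3]
  have hg2 := hg1.tangentPart (derivAlong b f x, derivAlong b (derivAlong c f) x)
  rw [derivAlong, dirDeriv_congr e4, dirDeriv_comp hg2 hfcb, dirDeriv_prodMk hfc
    ((hf.derivAlong b).prodMk (hc.derivAlong b)), dirDeriv_prodMk hf hc,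
    dirDeriv_prodMk (hf.derivAlong b) (hc.derivAlong b)]
  rfl

/-- If `g ∘ f = g ∘ f'` near `x` and the derivatives of order at most two of `f` and `f'` agree
at `x`, then the differential of `g` does not distinguish their third order derivatives. -/
theorem dirDeriv_derivAlong₃_sub_eq_zero {g : E → F} {f f' : D → E} {x : D} {e : E}
    (hg : IsCInftyAt g e) (hf : IsCInftyAt f x) (hf' : IsCInftyAt f' x) (hfe : f x = e)
    (hfe' : f' x = e) (hgf : (fun y => g (f y)) =ᶠ[𝓝 x] fun y => g (f' y)) {a b c : D}
    (ha : derivAlong a f x = derivAlong a f' x) (hb : derivAlong b f x = derivAlong b f' x)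
    (hc : derivAlong c f x = derivAlong c f' x)
    (hab : derivAlong a (derivAlong b f) x = derivAlong a (derivAlong b f') x)
    (hac : derivAlong a (derivAlong c f) x = derivAlong a (derivAlong c f') x)
    (hbc : derivAlong b (derivAlong c f) x = derivAlong b (derivAlong c f') x) :
    dirDeriv g e (derivAlong a (derivAlong b (derivAlong c f)) x -
      derivAlong a (derivAlong b (derivAlong c f')) x) = 0 := by
  have h := (derivAlong_congr (derivAlong_congr (derivAlong_congr hgf c) b) a).eq_of_nhds
  rw [derivAlong_comp₃ (hfe ▸ hg) hf, derivAlong_comp₃ (hfe' ▸ hg) hf', hfe, hfe', ha, hb, hc,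
    hab, hac, hbc, ← sub_eq_zero,
    ← dirDeriv_sub (((hg.tangentPart _).tangentPart _))] at h
  simp only [Prod.mk_sub_mk, sub_self] at h
  rwa [dirDeriv_tangentPart_zero (hg.tangentPart _), dirDeriv_tangentPart_zero hg]
    at h

end Germs

/-! ### Second and third order derivatives of local multiplications -/

section LocalMul

variable {D E E' F : Type u}
  [AddCommGroup D] [Module ℝ D] [TopologicalSpace D] [IsTopologicalAddGroup D]
  [ContinuousSMul ℝ D] [LocallyConvexSpace ℝ D] [T2Space D]
  [AddCommGroup E] [Module ℝ E] [TopologicalSpace E] [IsTopologicalAddGroup E]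
  [ContinuousSMul ℝ E] [LocallyConvexSpace ℝ E] [T2Space E]
  [AddCommGroup E'] [Module ℝ E'] [TopologicalSpace E'] [IsTopologicalAddGroup E']
  [ContinuousSMul ℝ E'] [LocallyConvexSpace ℝ E'] [T2Space E']
  [AddCommGroup F] [Module ℝ F] [TopologicalSpace F] [IsTopologicalAddGroup F]
  [ContinuousSMul ℝ F] [LocallyConvexSpace ℝ F] [T2Space F]

/-- Composition with an affine map `s` with linear part `L` commutes with directional
derivatives, for all functions. -/
theorem derivAlong_comp_affine (f : E → F) (s L : D → E)
    (hs : ∀ q w (h : ℝ), s (q + h • w) = s q + h • L w) (w : D) :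
    derivAlong w (fun q => f (s q)) = fun q => derivAlong (L w) f (s q) := by
  funext q
  have : diffQuot (fun q => f (s q)) q w = diffQuot f (s q) (L w) := by
    funext h; simp [diffQuot, hs]
  simp only [derivAlong, dirDeriv, this]

theorem derivAlong_slice_left (f : E × E' → F) (b : E') (x : E) :
    derivAlong x (fun u => f (u, b)) = fun u => derivAlong (x, 0) f (u, b) :=
  derivAlong_comp_affine f (fun u => (u, b)) (fun x => (x, 0)) (by simp) x

theorem derivAlong_slice_right (f : E × E' → F) (a : E) (y : E') :
    derivAlong y (fun u => f (a, u)) = fun u => derivAlong (0, y) f (a, u) :=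
  derivAlong_comp_affine f (fun u => (a, u)) (fun y => (0, y)) (by simp) y

/-- The mixed second derivative at `(e, e')` of a map of two variables. -/
noncomputable def mixedDeriv (m : E × E' → F) (e : E) (e' : E') (x : E) (y : E') : F :=
  derivAlong (x, 0) (derivAlong (0, y) m) (e, e')

theorem mixedDeriv_eq_slice (m : E × E' → F) (e : E) (e' : E') (x : E) (y : E') :
    mixedDeriv m e e' x y = dirDeriv (fun u => derivAlong (0, y) m (u, e')) e x :=
  (congrFun (derivAlong_slice_left (derivAlong (0, y) m) e' x) e).symm

theorem mixedDeriv_congr {m n : E × E' → F} {e : E} {e' : E'} (h : m =ᶠ[𝓝 (e, e')] n) :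
    mixedDeriv m e e' = mixedDeriv n e e' := by
  funext x y
  exact (derivAlong_congr (derivAlong_congr h _) _).eq_of_nhds

theorem mixedDeriv_swap {m : E × E' → F} {e : E} {e' : E'} (hm : IsCInftyAt m (e, e')) (x : E)
    (y : E') : mixedDeriv (fun p : E' × E => m (p.2, p.1)) e' e y x = mixedDeriv m e e' x y := by
  have h := derivAlong_comp_affine m (fun p : E' × E => (p.2, p.1)) (fun p => (p.2, p.1)) (by simp)
  have h' := derivAlong_comp_affine (derivAlong (x, 0) m) (fun p : E' × E => (p.2, p.1))
    (fun p => (p.2, p.1)) (by simp)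
  rw [mixedDeriv, h, h', mixedDeriv, derivAlong_comm hm]

theorem mixedDeriv_add_left {m : E × E' → F} {e : E} {e' : E'} (hm : IsCInftyAt m (e, e'))
    (x x' : E) (y : E') :
    mixedDeriv m e e' (x + x') y = mixedDeriv m e e' x y + mixedDeriv m e e' x' y := by
  have := dirDeriv_add (hm.derivAlong (0, y)) (x, 0) (x', 0)
  rwa [Prod.mk_add_mk, add_zero] at this

theorem mixedDeriv_smul_left {m : E × E' → F} {e : E} {e' : E'} (hm : IsCInftyAt m (e, e'))
    (c : ℝ) (x : E) (y : E') :
    mixedDeriv m e e' (c • x) y = c • mixedDeriv m e e' x y := by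
  have := dirDeriv_smul (hm.derivAlong (0, y)) c (x, 0)
  rwa [Prod.smul_mk, smul_zero] at this

theorem IsCInftyAt.swap {m : E × E' → F} {e : E} {e' : E'} (hm : IsCInftyAt m (e, e')) :
    IsCInftyAt (fun p : E' × E => m (p.2, p.1)) (e', e) :=
  hm.comp ((isCInftyAt_snd _).prodMk (isCInftyAt_fst _))

theorem mixedDeriv_add_right {m : E × E' → F} {e : E} {e' : E'} (hm : IsCInftyAt m (e, e'))
    (x : E) (y y' : E') :
    mixedDeriv m e e' x (y + y') = mixedDeriv m e e' x y + mixedDeriv m e e' x y' := by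
  simp only [← mixedDeriv_swap hm, mixedDeriv_add_left hm.swap]

theorem mixedDeriv_smul_right {m : E × E' → F} {e : E} {e' : E'} (hm : IsCInftyAt m (e, e'))
    (c : ℝ) (x : E) (y : E') :
    mixedDeriv m e e' x (c • y) = c • mixedDeriv m e e' x y := by
  simp only [← mixedDeriv_swap hm, mixedDeriv_smul_left hm.swap]

theorem mixedDeriv_sub_left {m : E × E' → F} {e : E} {e' : E'} (hm : IsCInftyAt m (e, e'))
    (x x' : E) (y : E') :
    mixedDeriv m e e' (x - x') y = mixedDeriv m e e' x y - mixedDeriv m e e' x' y := by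
  rw [eq_sub_iff_add_eq, ← mixedDeriv_add_left hm, sub_add_cancel]

theorem mixedDeriv_sub_right {m : E × E' → F} {e : E} {e' : E'} (hm : IsCInftyAt m (e, e'))
    (x : E) (y y' : E') :
    mixedDeriv m e e' x (y - y') = mixedDeriv m e e' x y - mixedDeriv m e e' x y' := by
  rw [eq_sub_iff_add_eq, ← mixedDeriv_add_right hm, sub_add_cancel]

theorem continuous_mixedDeriv {m : E × E' → F} {e : E} {e' : E'} (hm : IsCInftyAt m (e, e')) :
    Continuous (fun p : E × E' => mixedDeriv m e e' p.1 p.2) := by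
  have h1 : (fun p : E × E' => mixedDeriv m e e' p.1 p.2) = fun p =>
      tangentPart (tangentPart m) (((e, e'), (0, p.2)), ((p.1, 0), (0, 0))) := by
    funext p
    have h := dirDeriv_tangentPart hm (0, p.2) (p.1, 0) 0
    rw [dirDeriv_zero hm, add_zero] at h
    exact h.symm
  rw [h1]
  refine continuous_iff_continuousAt.2 fun p => ContinuousAt.comp
    (g := tangentPart (tangentPart m))
    (f := fun p : E × E' => (((e, e'), ((0 : E), p.2)), ((p.1, (0 : E')), ((0 : E), (0 : E')))))
    ((hm.tangentPart _).tangentPart _).continuousAt ?_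
  fun_prop

/-- The mixed second derivative of `m ∘ (k × l)`. -/
theorem mixedDeriv_comp_prodMap {D' : Type u} [AddCommGroup D'] [Module ℝ D'] [TopologicalSpace D']
    [IsTopologicalAddGroup D'] [ContinuousSMul ℝ D'] [LocallyConvexSpace ℝ D'] [T2Space D']
    {m : E × E' → F} {e : E} {e' : E'} (hm : IsCInftyAt m (e, e')) {k : D → E} {l : D' → E'}
    {d : D} {d' : D'} (hk : IsCInftyAt k d) (hl : IsCInftyAt l d') (hkd : k d = e)
    (hld : l d' = e') (x : D) (y : D') :
    mixedDeriv (fun p : D × D' => m (k p.1, l p.2)) d d' x y =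
      mixedDeriv m e e' (dirDeriv k d x) (dirDeriv l d' y) := by
  subst hkd hld
  have hs : IsCInftyAt (fun u => derivAlong (0, dirDeriv l d' y) m (u, l d')) (k d) :=
    (hm.derivAlong _).comp ((isCInftyAt_id _).prodMk (isCInftyAt_const _ _))
  rw [mixedDeriv_eq_slice, mixedDeriv_eq_slice, ← dirDeriv_comp hs hk]
  refine dirDeriv_congr ?_ x
  have hk' : ∀ᶠ u in 𝓝 d, IsCInftyAt m (k u, l d') := by
    have : Tendsto (fun u => (k u, l d')) (𝓝 d) (𝓝 (k d, l d')) :=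
      hk.continuousAt.prodMk continuousAt_const
    exact this.eventually hm.eventually
  filter_upwards [hk', hk.eventually] with u hu hku
  have hu' : IsCInftyAt (fun v => m (k u, v)) (l d') :=
    hu.comp ((isCInftyAt_const _ _).prodMk (isCInftyAt_id _))
  have h1 := congrFun (derivAlong_slice_right (fun p : D × D' => m (k p.1, l p.2)) u y) d'
  have h2 := congrFun (derivAlong_slice_right m (k u) (dirDeriv l d' y)) (l d')
  rw [← h1, ← h2]
  exact dirDeriv_comp hu' hl y

/-- `m` is a smooth multiplication with unit `e`, defined near `e`. -/
structure IsLocalUnitalMul (m : E × E → E) (e : E) : Prop where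
  smooth : IsCInftyAt m (e, e)
  mul_unit : ∀ᶠ x in 𝓝 e, m (x, e) = x
  unit_mul : ∀ᶠ x in 𝓝 e, m (e, x) = x

variable {m : E × E → E} {e : E}

theorem IsLocalUnitalMul.unit_mul_unit (hm : IsLocalUnitalMul m e) : m (e, e) = e :=
  hm.mul_unit.self_of_nhds

theorem IsLocalUnitalMul.swap (hm : IsLocalUnitalMul m e) :
    IsLocalUnitalMul (fun p => m (p.2, p.1)) e :=
  ⟨hm.smooth.swap, hm.unit_mul, hm.mul_unit⟩

theorem IsLocalUnitalMul.eventually_derivAlong_left (hm : IsLocalUnitalMul m e) (x : E) :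
    ∀ᶠ u in 𝓝 e, derivAlong (x, 0) m (u, e) = x := by
  have h := derivAlong_congr (g := fun u => u) hm.mul_unit x
  filter_upwards [h] with u hu
  rw [derivAlong_slice_left] at hu
  exact hu.trans (dirDeriv_id u x)

theorem IsLocalUnitalMul.eventually_derivAlong_right (hm : IsLocalUnitalMul m e) (x : E) :
    ∀ᶠ u in 𝓝 e, derivAlong (0, x) m (e, u) = x := by
  have h := derivAlong_congr (g := fun u => u) hm.unit_mul x
  filter_upwards [h] with u hu
  rw [derivAlong_slice_right] at hu
  exact hu.trans (dirDeriv_id u x)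

/-- The second order Taylor monomial of a unital multiplication is its mixed second derivative,
since the pure second derivatives vanish. -/
theorem IsLocalUnitalMul.dirDeriv₂_eq (hm : IsLocalUnitalMul m e) (x y : E) :
    (1 / 2 : ℝ) • dirDeriv₂ m (e, e) (x, y) (x, y) = mixedDeriv m e e x y := by
  have hx := hm.smooth.derivAlong (x, 0)
  have hy := hm.smooth.derivAlong (0, y)
  have e1 : (fun p => dirDeriv m p (x, y)) =ᶠ[𝓝 (e, e)]
      fun p => derivAlong (x, 0) m p + derivAlong (0, y) m p := by
    filter_upwards [hm.smooth.eventually] with p hp using dirDeriv_prod_split hp x y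
  have hxx : dirDeriv (derivAlong (x, 0) m) (e, e) (x, 0) = 0 := by
    have h := derivAlong_congr (g := fun _ => x) (hm.eventually_derivAlong_left x) x
    have h := h.eq_of_nhds
    rw [derivAlong_slice_left] at h
    exact h.trans (dirDeriv_const x e x)
  have hyy : dirDeriv (derivAlong (0, y) m) (e, e) (0, y) = 0 := by
    have h := derivAlong_congr (g := fun _ => y) (hm.eventually_derivAlong_right y) y
    have h := h.eq_of_nhds
    rw [derivAlong_slice_right] at h
    exact h.trans (dirDeriv_const y e y)
  have hxy : dirDeriv (derivAlong (x, 0) m) (e, e) (0, y) =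
      dirDeriv (derivAlong (0, y) m) (e, e) (x, 0) := derivAlong_comm hm.smooth _ _
  rw [dirDeriv₂, dirDeriv_congr e1, dirDeriv_fun_add hx hy, dirDeriv_prod_split hx,
    dirDeriv_prod_split hy, hxx, hyy, hxy, zero_add, add_zero, ← two_smul ℝ, smul_smul]
  norm_num
  rfl

/-- The mixed second derivative of `h ∘ m`: a symmetric term and the differential of `h` applied
to the mixed second derivative of `m`. -/
theorem IsLocalUnitalMul.mixedDeriv_comp (hm : IsLocalUnitalMul m e) {h : E → F}
    (hh : IsCInftyAt h e) (x y : E) :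
    mixedDeriv (fun p => h (m p)) e e x y =
      derivAlong x (derivAlong y h) e + dirDeriv h e (mixedDeriv m e e x y) := by
  have hk : IsCInftyAt (fun u => derivAlong (0, y) m (u, e)) e :=
    (hm.smooth.derivAlong _).comp ((isCInftyAt_id _).prodMk (isCInftyAt_const _ _))
  have hev : (fun u => derivAlong (0, y) (fun p => h (m p)) (u, e)) =ᶠ[𝓝 e]
      fun u => dirDeriv h u (derivAlong (0, y) m (u, e)) := by
    have ht : Tendsto (fun u : E => (u, e)) (𝓝 e) (𝓝 (e, e)) :=
      (continuousAt_id.prodMk continuousAt_const)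
    filter_upwards [ht.eventually hm.smooth.eventually, hh.eventually, hm.mul_unit]
      with u h1 h2 h3
    exact dirDeriv_comp h2 h1 _ h3
  rw [mixedDeriv_eq_slice, dirDeriv_congr hev, dirDeriv_dirDeriv_apply hh hk,
    (hm.eventually_derivAlong_right y).self_of_nhds, mixedDeriv_eq_slice]

/-- Smooth maps that are multiplicative near the unit preserve the antisymmetrized second
derivatives. -/
theorem IsLocalUnitalMul.dirDeriv_bracket (hm : IsLocalUnitalMul m e) {n : F × F → F} {e' : F}
    (hn : IsLocalUnitalMul n e') {h : E → F} (hh : IsCInftyAt h e) (he : h e = e')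
    (hmn : ∀ᶠ p in 𝓝 (e, e), h (m p) = n (h p.1, h p.2)) (x y : E) :
    dirDeriv h e (mixedDeriv m e e x y - mixedDeriv m e e y x) =
      mixedDeriv n e' e' (dirDeriv h e x) (dirDeriv h e y) -
        mixedDeriv n e' e' (dirDeriv h e y) (dirDeriv h e x) := by
  have key : ∀ x y, dirDeriv h e (mixedDeriv m e e x y) =
      mixedDeriv n e' e' (dirDeriv h e x) (dirDeriv h e y) - derivAlong x (derivAlong y h) e := by
    intro x y
    rw [eq_sub_iff_add_eq', ← hm.mixedDeriv_comp hh, mixedDeriv_congr hmn,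
      mixedDeriv_comp_prodMap hn.smooth hh hh he he]
  rw [dirDeriv_sub hh, key, key, derivAlong_comm hh y x]
  abel

end LocalMul

section Jacobi

variable {E F : Type u}
  [AddCommGroup E] [Module ℝ E] [TopologicalSpace E] [IsTopologicalAddGroup E]
  [ContinuousSMul ℝ E] [LocallyConvexSpace ℝ E] [T2Space E]
  [AddCommGroup F] [Module ℝ F] [TopologicalSpace F] [IsTopologicalAddGroup F]
  [ContinuousSMul ℝ F] [LocallyConvexSpace ℝ F] [T2Space F]

theorem derivAlong_slice₁₂ (f : E × E × E → F) (e : E) (w : E × E) :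
    derivAlong w (fun q : E × E => f (q.1, q.2, e)) =
      fun q => derivAlong (w.1, w.2, 0) f (q.1, q.2, e) :=
  derivAlong_comp_affine f (fun q : E × E => (q.1, q.2, e)) (fun w => (w.1, w.2, 0)) (by simp) w

theorem derivAlong_slice₁₃ (f : E × E × E → F) (e : E) (w : E × E) :
    derivAlong w (fun q : E × E => f (q.1, e, q.2)) =
      fun q => derivAlong (w.1, 0, w.2) f (q.1, e, q.2) :=
  derivAlong_comp_affine f (fun q : E × E => (q.1, e, q.2)) (fun w => (w.1, 0, w.2)) (by simp) w

theorem derivAlong_slice₂₃ (f : E × E × E → F) (e : E) (w : E × E) :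
    derivAlong w (fun q : E × E => f (e, q.1, q.2)) =
      fun q => derivAlong (0, w.1, w.2) f (e, q.1, q.2) :=
  derivAlong_comp_affine f (fun q : E × E => (e, q.1, q.2)) (fun w => (0, w.1, w.2)) (by simp) w

variable {m : E × E → E} {e : E}

/-- The trilinear third derivative of `(x y) z` at the unit: a term that is symmetric in `x` and
`y`, and the iterated mixed second derivative. -/
theorem IsLocalUnitalMul.derivAlong_mul_mul (hm : IsLocalUnitalMul m e) (x y z : E) :
    derivAlong (x, 0, 0) (derivAlong (0, y, 0) (derivAlong (0, 0, z)
      (fun p : E × E × E => m (m (p.1, p.2.1), p.2.2)))) (e, e, e) =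
      derivAlong x (derivAlong y (fun u => derivAlong (0, z) m (u, e))) e +
        mixedDeriv m e e (mixedDeriv m e e x y) z := by
  have hR : IsCInftyAt (fun u => derivAlong (0, z) m (u, e)) e :=
    (hm.smooth.derivAlong _).comp ((isCInftyAt_id _).prodMk (isCInftyAt_const _ _))
  rw [mixedDeriv_eq_slice m e e (mixedDeriv m e e x y) z, ← hm.mixedDeriv_comp hR]
  have h1 : (fun p : E × E => derivAlong (0, z) m (m p, e)) =
      fun p => derivAlong (0, 0, z) (fun p : E × E × E => m (m (p.1, p.2.1), p.2.2))
        (p.1, p.2, e) := by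
    funext p
    have a := congrFun (derivAlong_slice_right m (m p) z) e
    have b := congrFun (derivAlong_comp_affine
      (fun p : E × E × E => m (m (p.1, p.2.1), p.2.2)) (fun v => (p.1, p.2, v))
      (fun v => (0, 0, v)) (by simp) z) e
    exact a.symm.trans b
  rw [h1, mixedDeriv, derivAlong_slice₁₂, derivAlong_slice₁₂]

/-- The trilinear third derivative of `x (y z)` at the unit. -/
theorem IsLocalUnitalMul.derivAlong_mul_mul' (hm : IsLocalUnitalMul m e) (x y z : E) :
    derivAlong (x, 0, 0) (derivAlong (0, y, 0) (derivAlong (0, 0, z)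
      (fun p : E × E × E => m (p.1, m (p.2.1, p.2.2))))) (e, e, e) =
      derivAlong z (derivAlong y (fun u => derivAlong (x, 0) m (e, u))) e +
        mixedDeriv m e e x (mixedDeriv m e e y z) := by
  -- apply the formula for `(x y) z` to the opposite multiplication and reverse the variables
  set f : E × E × E → E := fun p => m (p.1, m (p.2.1, p.2.2)) with hf
  have hin : IsCInftyAt (fun p : E × E × E => m (p.2.1, p.2.2)) (e, e, e) :=
    hm.smooth.comp (isCInftyAt_snd (E := E) (F := E × E) (e, e, e))
  have hsm : IsCInftyAt f (e, e, e) :=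
    hm.smooth.comp ((isCInftyAt_fst (E := E) (F := E × E) (e, e, e)).prodMk hin)
      (by rw [hm.unit_mul_unit])
  have hrev := fun (g : E × E × E → E) => derivAlong_comp_affine g
    (fun p : E × E × E => (p.2.2, p.2.1, p.1)) (fun p => (p.2.2, p.2.1, p.1)) (by simp)
  have h := hm.swap.derivAlong_mul_mul z y x
  have hfun : (fun p : E × E × E => m (p.2.2, m (p.2.1, p.1))) =
      fun p => f (p.2.2, p.2.1, p.1) := rfl
  have hslice : (fun u => derivAlong (0, x) (fun p : E × E => m (p.2, p.1)) (u, e)) =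
      fun u => derivAlong (x, 0) m (e, u) := by
    funext u
    exact congrFun (derivAlong_comp_affine m (fun p : E × E => (p.2, p.1))
      (fun p => (p.2, p.1)) (by simp) (0, x)) (u, e)
  simp only [hfun, hrev, hslice, mixedDeriv_swap hm.smooth] at h
  rw [← h]
  have e1 := derivAlong_comm_eventually hsm (0, y, 0) (0, 0, z)
  have e2 := derivAlong_comm_eventually hsm (0, y, 0) (x, 0, 0)
  rw [(derivAlong_congr e1 _).eq_of_nhds, derivAlong_comm (hsm.derivAlong _),
    (derivAlong_congr (derivAlong_comm_eventually hsm (x, 0, 0) (0, y, 0)) _).eq_of_nhds]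

/-- `m` is a smooth unital multiplication near `e` that is associative up to the equivalence
relation "`s` times the inverse of `t` is the unit". -/
structure IsWeaklyAssocMul (m : E × E → E) (e : E) : Prop extends IsLocalUnitalMul m e where
  exists_inv : ∃ i : E → E, IsCInftyAt i e ∧ i e = e ∧ (∀ᶠ x in 𝓝 e, m (x, i x) = e) ∧
    ∀ᶠ p : E × E × E in 𝓝 (e, e, e),
      m (m (p.1, m (p.2.1, p.2.2)), i (m (m (p.1, p.2.1), p.2.2))) = e

/-- The third derivatives of `(x y) z` and `x (y z)` agree: the derivatives of order at most two
agree since the unit is strict, and `(s, t) ↦ s t⁻¹` takes the same values on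
`(x (y z), (x y) z)` and on `((x y) z, (x y) z)`, with partial differential the identity. -/
theorem IsWeaklyAssocMul.derivAlong_assoc (hm : IsWeaklyAssocMul m e) (x y z : E) :
    derivAlong (x, 0, 0) (derivAlong (0, y, 0) (derivAlong (0, 0, z)
      (fun p : E × E × E => m (p.1, m (p.2.1, p.2.2))))) (e, e, e) =
    derivAlong (x, 0, 0) (derivAlong (0, y, 0) (derivAlong (0, 0, z)
      (fun p : E × E × E => m (m (p.1, p.2.1), p.2.2)))) (e, e, e) := by
  obtain ⟨i, hi, hie, hinv, hassoc⟩ := hm.exists_inv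
  have hee := hm.unit_mul_unit
  set r : E × E × E → E := fun p => m (p.1, m (p.2.1, p.2.2)) with hr
  set l : E × E × E → E := fun p => m (m (p.1, p.2.1), p.2.2) with hl
  have hre : r (e, e, e) = e := by simp [hr, hee]
  have hle : l (e, e, e) = e := by simp [hl, hee]
  have h1 := isCInftyAt_fst (E := E) (F := E × E) (e, e, e)
  have h2 := isCInftyAt_snd (E := E) (F := E × E) (e, e, e)
  have h21 : IsCInftyAt (fun p : E × E × E => p.2.1) (e, e, e) :=
    (isCInftyAt_fst (E := E) (F := E) (e, e)).comp h2
  have h22 : IsCInftyAt (fun p : E × E × E => p.2.2) (e, e, e) :=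
    (isCInftyAt_snd (E := E) (F := E) (e, e)).comp h2
  have hrs : IsCInftyAt r (e, e, e) :=
    hm.smooth.comp (h1.prodMk (hm.smooth.comp (h21.prodMk h22))) (by rw [hee])
  have hls : IsCInftyAt l (e, e, e) :=
    hm.smooth.comp ((hm.smooth.comp (h1.prodMk h21)).prodMk h22) (by rw [hee])
  -- the two triple products agree where one of the factors is the unit
  have hfst : Tendsto (fun q : E × E => q.1) (𝓝 (e, e)) (𝓝 e) := continuousAt_fst
  have hsnd : Tendsto (fun q : E × E => q.2) (𝓝 (e, e)) (𝓝 e) := continuousAt_snd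
  have hmul : Tendsto m (𝓝 (e, e)) (𝓝 e) := by
    simpa only [ContinuousAt, hee] using hm.smooth.continuousAt
  have s₁₂ : (fun q : E × E => r (q.1, q.2, e)) =ᶠ[𝓝 (e, e)] fun q => l (q.1, q.2, e) := by
    filter_upwards [hsnd.eventually hm.mul_unit, hmul.eventually hm.mul_unit] with q a b
    simp only [hr, hl, a, b]
  have s₁₃ : (fun q : E × E => r (q.1, e, q.2)) =ᶠ[𝓝 (e, e)] fun q => l (q.1, e, q.2) := by
    filter_upwards [hfst.eventually hm.mul_unit, hsnd.eventually hm.unit_mul] with q a b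
    simp only [hr, hl, a, b]
  have s₂₃ : (fun q : E × E => r (e, q.1, q.2)) =ᶠ[𝓝 (e, e)] fun q => l (e, q.1, q.2) := by
    filter_upwards [hfst.eventually hm.unit_mul, hmul.eventually hm.unit_mul] with q a b
    simp only [hr, hl, a, b]
  have d₁₂ := fun v w => (derivAlong_congr (derivAlong_congr s₁₂ w) v).eq_of_nhds
  have d₁₃ := fun v w => (derivAlong_congr (derivAlong_congr s₁₃ w) v).eq_of_nhds
  have d₂₃ := fun v w => (derivAlong_congr (derivAlong_congr s₂₃ w) v).eq_of_nhds
  have f₁₂ := fun v => (derivAlong_congr s₁₂ v).eq_of_nhds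
  have f₂₃ := fun v => (derivAlong_congr s₂₃ v).eq_of_nhds
  simp only [derivAlong_slice₁₂] at d₁₂ f₁₂
  simp only [derivAlong_slice₁₃] at d₁₃
  simp only [derivAlong_slice₂₃] at d₂₃ f₂₃
  -- the map `(s, t) ↦ s t⁻¹` agrees on the pairs `(x (y z), (x y) z)` and `((x y) z, (x y) z)`
  have hΨ : IsCInftyAt (fun p : E × E => m (p.1, i p.2)) (e, e) :=
    hm.smooth.comp ((isCInftyAt_fst (E := E) (F := E) (e, e)).prodMk
      (hi.comp (isCInftyAt_snd (E := E) (F := E) (e, e)))) (by rw [hie])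
  have hlt : Tendsto l (𝓝 (e, e, e)) (𝓝 e) := by
    simpa only [ContinuousAt, hle] using hls.continuousAt
  have hagree : (fun p => (fun q : E × E => m (q.1, i q.2)) (r p, l p)) =ᶠ[𝓝 (e, e, e)]
      fun p => (fun q : E × E => m (q.1, i q.2)) (l p, l p) := by
    filter_upwards [hassoc, hlt.eventually hinv] with p a b
    exact a.trans b.symm
  have hpair : ∀ {f g : E × E × E → E}, IsCInftyAt f (e, e, e) → IsCInftyAt g (e, e, e) →
      ∀ w, derivAlong w (fun p => (f p, g p)) =ᶠ[𝓝 (e, e, e)]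
        fun p => (derivAlong w f p, derivAlong w g p) := fun hf hg w => by
    filter_upwards [hf.eventually, hg.eventually] with p a b using dirDeriv_prodMk a b w
  have hpair₂ : ∀ {f g : E × E × E → E}, IsCInftyAt f (e, e, e) → IsCInftyAt g (e, e, e) →
      ∀ v w, derivAlong v (derivAlong w (fun p => (f p, g p))) =ᶠ[𝓝 (e, e, e)]
        fun p => (derivAlong v (derivAlong w f) p, derivAlong v (derivAlong w g) p) :=
    fun hf hg v w => (derivAlong_congr (hpair hf hg w) v).trans
      (hpair (hf.derivAlong w) (hg.derivAlong w) v)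
  have hpair₃ : ∀ {f g : E × E × E → E}, IsCInftyAt f (e, e, e) → IsCInftyAt g (e, e, e) →
      ∀ u v w, derivAlong u (derivAlong v (derivAlong w (fun p => (f p, g p)))) (e, e, e) =
        (derivAlong u (derivAlong v (derivAlong w f)) (e, e, e),
          derivAlong u (derivAlong v (derivAlong w g)) (e, e, e)) := fun hf hg u v w =>
    ((derivAlong_congr (hpair₂ hf hg v w) u).trans
      (hpair ((hf.derivAlong w).derivAlong v) ((hg.derivAlong w).derivAlong v) u)).eq_of_nhds
  have key := dirDeriv_derivAlong₃_sub_eq_zero (a := (x, 0, 0)) (b := (0, y, 0)) (c := (0, 0, z))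
    hΨ (hrs.prodMk hls) (hls.prodMk hls) (by rw [hre, hle]) (by rw [hle]) hagree
    (by rw [(hpair hrs hls _).eq_of_nhds, (hpair hls hls _).eq_of_nhds, f₁₂ (x, 0)])
    (by rw [(hpair hrs hls _).eq_of_nhds, (hpair hls hls _).eq_of_nhds, f₁₂ (0, y)])
    (by rw [(hpair hrs hls _).eq_of_nhds, (hpair hls hls _).eq_of_nhds, f₂₃ (0, z)])
    (by rw [(hpair₂ hrs hls _ _).eq_of_nhds, (hpair₂ hls hls _ _).eq_of_nhds,
      d₁₂ (x, 0) (0, y)])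
    (by rw [(hpair₂ hrs hls _ _).eq_of_nhds, (hpair₂ hls hls _ _).eq_of_nhds,
      d₁₃ (x, 0) (0, z)])
    (by rw [(hpair₂ hrs hls _ _).eq_of_nhds, (hpair₂ hls hls _ _).eq_of_nhds,
      d₂₃ (y, 0) (0, z)])
  rw [hpair₃ hrs hls, hpair₃ hls hls, Prod.mk_sub_mk, sub_self] at key
  have hleft : (fun s => m (s, i e)) =ᶠ[𝓝 e] fun s => s := by
    rw [hie]; exact hm.mul_unit
  have hid := fun w => (derivAlong_congr hleft w).eq_of_nhds
  simp only [derivAlong_slice_left (fun p : E × E => m (p.1, i p.2)) e] at hid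
  exact sub_eq_zero.1 (((hid _).trans (dirDeriv_id e _)).symm.trans key)

/-- If the associator of a biadditive operation `B` is the difference of a function `T` symmetric in
the last two arguments and a function `S` symmetric in the first two, then the commutator of `B`
satisfies the Jacobi identity. -/
theorem jacobi_of_associator {L : Type u} [AddCommGroup L] (B : L → L → L)
    (hl : ∀ x x' y, B (x - x') y = B x y - B x' y) (hr : ∀ x y y', B x (y - y') = B x y - B x y')
    (S T : L → L → L → L) (hS : ∀ x y z, S x y z = S y x z) (hT : ∀ x y z, T x y z = T x z y)
    (h : ∀ x y z, T x y z + B x (B y z) = S x y z + B (B x y) z) (x y z : L) :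
    (B x (B y z - B z y) - B (B y z - B z y) x) + (B y (B z x - B x z) - B (B z x - B x z) y) +
      (B z (B x y - B y x) - B (B x y - B y x) z) = 0 := by
  have key : ∀ x y z, B x (B y z) = S x y z + B (B x y) z - T x y z := fun x y z => by
    rw [← h, add_sub_cancel_left]
  simp only [hl, hr]
  rw [key x y z, key x z y, key y z x, key y x z, key z x y, key z y x,
    hS y x z, hS z x y, hS z y x, hT x z y, hT y z x, hT z y x]
  abel

/-- By the equality of third derivatives the associator of the mixed second derivative is the
difference of a term symmetric in the last two arguments and one symmetric in the first two. -/
theorem IsWeaklyAssocMul.jacobi (hm : IsWeaklyAssocMul m e) (x y z : E) :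
    let B := mixedDeriv m e e
    (B x (B y z - B z y) - B (B y z - B z y) x) + (B y (B z x - B x z) - B (B z x - B x z) y) +
      (B z (B x y - B y x) - B (B x y - B y x) z) = 0 := by
  have hR : ∀ z, IsCInftyAt (fun u => derivAlong (0, z) m (u, e)) e := fun z =>
    (hm.smooth.derivAlong _).comp ((isCInftyAt_id _).prodMk (isCInftyAt_const _ _))
  have hL : ∀ x, IsCInftyAt (fun u => derivAlong (x, 0) m (e, u)) e := fun x =>
    (hm.smooth.derivAlong _).comp ((isCInftyAt_const _ _).prodMk (isCInftyAt_id _))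
  refine jacobi_of_associator (mixedDeriv m e e)
    (fun x y z => mixedDeriv_sub_left hm.smooth x y z)
    (fun x y z => mixedDeriv_sub_right hm.smooth x y z)
    (fun x y z => derivAlong x (derivAlong y (fun u => derivAlong (0, z) m (u, e))) e)
    (fun x y z => derivAlong z (derivAlong y (fun u => derivAlong (x, 0) m (e, u))) e)
    (fun x y z => derivAlong_comm (hR z) x y) (fun x y z => derivAlong_comm (hL x) z y)
    (fun x y z => ?_) x y z
  rw [← hm.derivAlong_mul_mul', ← hm.derivAlong_mul_mul]
  exact hm.derivAlong_assoc x y z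

/-- The antisymmetrized second derivative of a weakly associative multiplication is a Lie
bracket. -/
theorem IsWeaklyAssocMul.isLCLieBracket (hm : IsWeaklyAssocMul m e) :
    IsLCLieBracket (fun x y => mixedDeriv m e e x y - mixedDeriv m e e y x) where
  continuous_br := by
    have h := continuous_mixedDeriv hm.smooth
    have h' : Continuous (fun p : E × E => mixedDeriv m e e p.2 p.1) :=
      Continuous.comp (g := fun p : E × E => mixedDeriv m e e p.1 p.2) (f := Prod.swap) h
        continuous_swap
    exact Continuous.sub h h'
  add_left x y z := by
    rw [mixedDeriv_add_left hm.smooth, mixedDeriv_add_right hm.smooth, add_sub_add_comm]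
  smul_left c x y := by
    rw [mixedDeriv_smul_left hm.smooth, mixedDeriv_smul_right hm.smooth, smul_sub]
  add_right x y z := by
    rw [mixedDeriv_add_left hm.smooth, mixedDeriv_add_right hm.smooth, add_sub_add_comm]
  smul_right c x y := by
    rw [mixedDeriv_smul_left hm.smooth, mixedDeriv_smul_right hm.smooth, smul_sub]
  alternating x := sub_self _
  jacobi x y z := hm.jacobi x y z

end Jacobi

/-! ### Germs of smooth maps between manifolds at base points -/

section ManifoldGerms

variable {M N P : Type u} [TopologicalSpace M] [TopologicalSpace N] [TopologicalSpace P]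
  [LCManifold M] [LCManifold N] [LCManifold P]

/-- `f` maps `p` to `q`, and it is smooth near `p` in the preferred charts at `p` and `q`. -/
structure IsSmoothGerm (f : M → N) (p : M) (q : N) : Prop where
  map_eq : f p = q
  continuousAt : ContinuousAt f p
  smooth : IsCInftyAt (coordRep f p q) (chartAt (Model M) p p)

theorem chartAt_symm_self (p : M) :
    (chartAt (Model M) p).symm (chartAt (Model M) p p) = p :=
  (chartAt (Model M) p).left_inv (mem_chart_source _ p)

theorem tendsto_chartAt_symm (p : M) :
    Tendsto (chartAt (Model M) p).symm (𝓝 (chartAt (Model M) p p)) (𝓝 p) := by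
  have h := (chartAt (Model M) p).continuousAt_symm (mem_chart_target _ p)
  rwa [ContinuousAt, chartAt_symm_self] at h

theorem eventually_mem_chartAt_source (p : M) : ∀ᶠ x in 𝓝 p, x ∈ (chartAt (Model M) p).source :=
  (chartAt (Model M) p).open_source.mem_nhds (mem_chart_source _ p)

theorem SmoothOnSet.isSmoothGerm {f : M → N} {S : Set M} (hf : SmoothOnSet f S) (hS : IsOpen S)
    {p : M} (hp : p ∈ S) {q : N} (hq : f p = q) : IsSmoothGerm f p q := by
  subst hq
  refine ⟨rfl, hf.1.continuousAt (hS.mem_nhds hp), ?_⟩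
  refine ⟨_, ?_, ?_, hf.2 _ (chart_mem_atlas _ p) _ (chart_mem_atlas _ (f p))⟩
  · exact (chartAt (Model M) p).isOpen_inter_preimage_symm
      (hf.1.isOpen_inter_preimage hS (chartAt (Model N) (f p)).open_source)
  · refine ⟨mem_chart_target _ p, ?_⟩
    rw [mem_preimage, chartAt_symm_self]
    exact ⟨hp, mem_chart_source _ _⟩

theorem SmoothMap.isSmoothGerm {f : M → N} (hf : SmoothMap f) {p : M} {q : N} (hq : f p = q) :
    IsSmoothGerm f p q :=
  SmoothOnSet.isSmoothGerm hf isOpen_univ (mem_univ p) hq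

theorem IsSmoothGerm.tendsto {f : M → N} {p : M} {q : N} (hf : IsSmoothGerm f p q) :
    Tendsto f (𝓝 p) (𝓝 q) := by
  simpa only [ContinuousAt, hf.map_eq] using hf.continuousAt

theorem coordRep_self {f : M → N} {p : M} {q : N} (h : f p = q) :
    coordRep f p q (chartAt (Model M) p p) = chartAt (Model N) q q := by
  rw [coordRep, chartAt_symm_self, h]

theorem coordRep_congr {f g : M → N} {p : M} {q : N} (h : f =ᶠ[𝓝 p] g) :
    coordRep f p q =ᶠ[𝓝 (chartAt (Model M) p p)] coordRep g p q := by
  filter_upwards [(tendsto_chartAt_symm p).eventually h] with x hx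
  rw [coordRep, hx, coordRep]

theorem coordRep_comp (g : N → P) {f : M → N} {p : M} {q : N} {r : P}
    (hf : Tendsto f (𝓝 p) (𝓝 q)) :
    coordRep (fun x => g (f x)) p r =ᶠ[𝓝 (chartAt (Model M) p p)]
      fun x => coordRep g q r (coordRep f p q x) := by
  filter_upwards [(tendsto_chartAt_symm p).eventually
    (hf.eventually (eventually_mem_chartAt_source q))] with x hx
  rw [coordRep, coordRep, coordRep, (chartAt (Model N) q).left_inv hx]

theorem IsSmoothGerm.comp {g : N → P} {f : M → N} {p : M} {q : N} {r : P}
    (hg : IsSmoothGerm g q r) (hf : IsSmoothGerm f p q) :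
    IsSmoothGerm (fun x => g (f x)) p r := by
  refine ⟨by rw [hf.map_eq, hg.map_eq], ?_, ?_⟩
  · have h : Tendsto (fun x => g (f x)) (𝓝 p) (𝓝 r) := hg.tendsto.comp hf.tendsto
    rwa [ContinuousAt, hf.map_eq, hg.map_eq]
  · exact (hg.smooth.comp hf.smooth (coordRep_self hf.map_eq)).congr (coordRep_comp g hf.tendsto)

theorem isSmoothGerm_id (p : M) : IsSmoothGerm (fun x : M => x) p p := by
  refine ⟨rfl, continuousAt_id, (isCInftyAt_id _).congr ?_⟩
  filter_upwards [(chartAt (Model M) p).open_target.mem_nhds (mem_chart_target _ p)] with x hx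
  exact (chartAt (Model M) p).right_inv hx

theorem isSmoothGerm_const (p : M) (q : N) : IsSmoothGerm (fun _ : M => q) p q :=
  ⟨rfl, continuousAt_const, isCInftyAt_const _ _⟩

theorem IsSmoothGerm.prodMk {f : M → N} {g : M → P} {p : M} {q : N} {r : P}
    (hf : IsSmoothGerm f p q) (hg : IsSmoothGerm g p r) :
    IsSmoothGerm (fun x => (f x, g x)) p (q, r) :=
  ⟨by rw [hf.map_eq, hg.map_eq], hf.continuousAt.prodMk hg.continuousAt,
    hf.smooth.prodMk hg.smooth⟩

theorem isSmoothGerm_snd (p : M) (q : N) : IsSmoothGerm (fun x : M × N => x.2) (p, q) q := by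
  refine ⟨rfl, continuousAt_snd, ?_⟩
  refine IsCInftyAt.congr (isCInftyAt_snd (E := Model M) (F := Model N)
    (chartAt (Model M) p p, chartAt (Model N) q q)) ?_
  filter_upwards [(chartAt (Model (M × N)) (p, q)).open_target.mem_nhds (mem_chart_target _ (p, q))]
    with x hx
  exact (chartAt (Model N) q).right_inv hx.2

theorem pointedDiff_congr {f g : M → N} {p : M} (q : N) (h : f =ᶠ[𝓝 p] g) :
    pointedDiff f p q = pointedDiff g p q := by
  funext w
  exact dirDeriv_congr (coordRep_congr h) w

theorem pointedDiff_comp {g : N → P} {f : M → N} {p : M} {q : N} {r : P}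
    (hg : IsSmoothGerm g q r) (hf : IsSmoothGerm f p q) (w : Model M) :
    pointedDiff (fun x => g (f x)) p r w = pointedDiff g q r (pointedDiff f p q w) := by
  rw [pointedDiff, dirDeriv_congr (coordRep_comp g hf.tendsto),
    dirDeriv_comp hg.smooth hf.smooth w (coordRep_self hf.map_eq)]
  rfl

theorem pointedDiff_id (p : M) (w : Model M) : pointedDiff (fun x : M => x) p p w = w := by
  refine (dirDeriv_congr ?_ w).trans (dirDeriv_id _ w)
  filter_upwards [(chartAt (Model M) p).open_target.mem_nhds (mem_chart_target _ p)] with x hx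
  exact (chartAt (Model M) p).right_inv hx

theorem pointedDiff_const (p : M) (q : N) (w : Model M) :
    pointedDiff (fun _ : M => q) p q w = 0 :=
  dirDeriv_const _ _ w

theorem pointedDiff_prodMk {f : M → N} {g : M → P} {p : M} {q : N} {r : P}
    (hf : IsSmoothGerm f p q) (hg : IsSmoothGerm g p r) (w : Model M) :
    pointedDiff (fun x => (f x, g x)) p (q, r) w =
      ((pointedDiff f p q w, pointedDiff g p r w) : Model N × Model P) :=
  dirDeriv_prodMk hf.smooth hg.smooth w

theorem IsSmoothGerm.isLinearMap {f : M → N} {p : M} {q : N} (hf : IsSmoothGerm f p q) :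
    IsLinearMap ℝ (pointedDiff f p q) :=
  ⟨dirDeriv_add hf.smooth, dirDeriv_smul hf.smooth⟩

theorem IsSmoothGerm.continuous_pointedDiff {f : M → N} {p : M} {q : N}
    (hf : IsSmoothGerm f p q) : Continuous (pointedDiff f p q) :=
  hf.smooth.continuous_dirDeriv

/-- The differential at the unit of a product of two maps is the sum of the differentials. -/
theorem pointedDiff_mul {mul : N → N → N} {e : N} (he : ∀ x, mul x e = x) (he' : ∀ x, mul e x = x)
    (hmul : IsSmoothGerm (fun x : N × N => mul x.1 x.2) (e, e) e) {f g : M → N} {p : M}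
    (hf : IsSmoothGerm f p e) (hg : IsSmoothGerm g p e) (w : Model M) :
    pointedDiff (fun x => mul (f x) (g x)) p e w = pointedDiff f p e w + pointedDiff g p e w := by
  have hl : ∀ v : Model N, pointedDiff (fun x : N × N => mul x.1 x.2) (e, e) e
      ((v, 0) : Model N × Model N) = v := fun v => by
    have h := pointedDiff_comp hmul ((isSmoothGerm_id e).prodMk (isSmoothGerm_const e e)) v
    rw [pointedDiff_prodMk (isSmoothGerm_id e) (isSmoothGerm_const e e), pointedDiff_id,
      pointedDiff_const] at h
    simp only [he, pointedDiff_id] at h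
    exact h.symm
  have hr : ∀ v : Model N, pointedDiff (fun x : N × N => mul x.1 x.2) (e, e) e
      ((0, v) : Model N × Model N) = v := fun v => by
    have h := pointedDiff_comp hmul ((isSmoothGerm_const e e).prodMk (isSmoothGerm_id e)) v
    rw [pointedDiff_prodMk (isSmoothGerm_const e e) (isSmoothGerm_id e), pointedDiff_id,
      pointedDiff_const] at h
    simp only [he', pointedDiff_id] at h
    exact h.symm
  rw [pointedDiff_comp hmul (hf.prodMk hg), pointedDiff_prodMk hf hg]
  refine (dirDeriv_prod_split (D := Model N) (E := Model N) hmul.smooth _ _).trans ?_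
  exact congrArg₂ (· + ·) (hl _) (hr _)

/-- If `mul x (inv x) = e` near the unit, the differential of `inv` at the unit is `-1`. -/
theorem pointedDiff_inv {mul : N → N → N} {inv : N → N} {e : N} (he : ∀ x, mul x e = x)
    (he' : ∀ x, mul e x = x) (hinv : ∀ x, mul x (inv x) = e)
    (hmul : IsSmoothGerm (fun x : N × N => mul x.1 x.2) (e, e) e) (hi : IsSmoothGerm inv e e)
    (w : Model N) : pointedDiff inv e e w = -w := by
  have h := pointedDiff_mul he he' hmul (isSmoothGerm_id e) hi w
  simp only [hinv] at h
  rw [pointedDiff_const, pointedDiff_id] at h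
  exact (neg_eq_of_add_eq_zero_right h.symm).symm

end ManifoldGerms

/-! ### The Lie algebra of a weakly associative 2-group -/

section TwoGroupLie

variable {C₀ C₁ : Type u} [TopologicalSpace C₀] [LCManifold C₀]

theorem TwoGroup.inv_one₀ (𝒢 : TwoGroup C₀ C₁) : 𝒢.inv₀ 𝒢.one = 𝒢.one := by
  rw [← 𝒢.one_mul₀ (𝒢.inv₀ 𝒢.one), 𝒢.mul_inv₀]

theorem TwoGroup.idm_injective (𝒢 : TwoGroup C₀ C₁) : Function.Injective 𝒢.idm := fun x y h => by
  rw [← 𝒢.src_idm x, h, 𝒢.src_idm]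

/-- The multiplication of objects in the preferred chart at the unit. -/
noncomputable def TwoGroup.chartMul (𝒢 : TwoGroup C₀ C₁) : Model C₀ × Model C₀ → Model C₀ :=
  fun p => chartAt (Model C₀) 𝒢.one (𝒢.mul₀ ((chartAt (Model C₀) 𝒢.one).symm p.1)
    ((chartAt (Model C₀) 𝒢.one).symm p.2))

/-- The coordinates of the unit. -/
noncomputable def TwoGroup.chartOne (𝒢 : TwoGroup C₀ C₁) : Model C₀ :=
  chartAt (Model C₀) 𝒢.one 𝒢.one

/-- A 2-group whose multiplication and inversion are smooth near the unit on objects, such that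
`(x (y z)) ((x y) z)⁻¹ = 1` for objects near the unit. -/
structure TwoGroup.IsWeaklyAssoc (𝒢 : TwoGroup C₀ C₁) : Prop where
  mul : IsSmoothGerm (fun p : C₀ × C₀ => 𝒢.mul₀ p.1 p.2) (𝒢.one, 𝒢.one) 𝒢.one
  inv : IsSmoothGerm 𝒢.inv₀ 𝒢.one 𝒢.one
  assoc : ∀ᶠ p : C₀ × C₀ × C₀ in 𝓝 (𝒢.one, 𝒢.one, 𝒢.one),
    𝒢.mul₀ (𝒢.mul₀ p.1 (𝒢.mul₀ p.2.1 p.2.2)) (𝒢.inv₀ (𝒢.mul₀ (𝒢.mul₀ p.1 p.2.1) p.2.2)) = 𝒢.one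

variable {𝒢 : TwoGroup C₀ C₁}

theorem TwoGroup.isLocalUnitalMul
    (hmul : IsSmoothGerm (fun p : C₀ × C₀ => 𝒢.mul₀ p.1 p.2) (𝒢.one, 𝒢.one) 𝒢.one) :
    IsLocalUnitalMul 𝒢.chartMul 𝒢.chartOne := by
  have hev : ∀ᶠ x in 𝓝 𝒢.chartOne, x ∈ (chartAt (Model C₀) 𝒢.one).target :=
    (chartAt (Model C₀) 𝒢.one).open_target.mem_nhds (mem_chart_target _ _)
  refine ⟨hmul.smooth, ?_, ?_⟩ <;> filter_upwards [hev] with x hx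
  · simp only [chartMul, chartOne, chartAt_symm_self, 𝒢.mul_one₀]
    exact (chartAt (Model C₀) 𝒢.one).right_inv hx
  · simp only [chartMul, chartOne, chartAt_symm_self, 𝒢.one_mul₀]
    exact (chartAt (Model C₀) 𝒢.one).right_inv hx

theorem TwoGroup.lieBracket_eq
    (hmul : IsSmoothGerm (fun p : C₀ × C₀ => 𝒢.mul₀ p.1 p.2) (𝒢.one, 𝒢.one) 𝒢.one) :
    𝒢.lieBracket = fun x y => mixedDeriv 𝒢.chartMul 𝒢.chartOne 𝒢.chartOne x y -
      mixedDeriv 𝒢.chartMul 𝒢.chartOne 𝒢.chartOne y x := by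
  have h : ∀ x y, 𝒢.taylorMul x y = mixedDeriv 𝒢.chartMul 𝒢.chartOne 𝒢.chartOne x y :=
    (TwoGroup.isLocalUnitalMul hmul).dirDeriv₂_eq
  funext x y
  rw [lieBracket, h, h]

theorem TwoGroup.IsWeaklyAssoc.isWeaklyAssocMul (h : 𝒢.IsWeaklyAssoc) :
    IsWeaklyAssocMul 𝒢.chartMul 𝒢.chartOne := by
  set φ := chartAt (Model C₀) 𝒢.one with hφ
  have ht : Tendsto φ.symm (𝓝 𝒢.chartOne) (𝓝 𝒢.one) := tendsto_chartAt_symm _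
  have hsrc := eventually_mem_chartAt_source 𝒢.one
  refine ⟨TwoGroup.isLocalUnitalMul h.mul, coordRep 𝒢.inv₀ 𝒢.one 𝒢.one, h.inv.smooth,
    coordRep_self 𝒢.inv_one₀, ?_, ?_⟩
  · filter_upwards [ht.eventually (h.inv.tendsto.eventually hsrc)] with x hx
    simp only [chartMul, coordRep]
    rw [φ.left_inv hx, 𝒢.mul_inv₀]
    rfl
  · have hmul := h.mul.tendsto
    have ht3 : Tendsto (fun p : Model C₀ × Model C₀ × Model C₀ =>
        (φ.symm p.1, φ.symm p.2.1, φ.symm p.2.2)) (𝓝 (𝒢.chartOne, 𝒢.chartOne, 𝒢.chartOne))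
        (𝓝 (𝒢.one, 𝒢.one, 𝒢.one)) := by
      simp only [nhds_prod_eq]
      exact ht.prodMap (ht.prodMap ht)
    have h12 : Tendsto (fun p : C₀ × C₀ × C₀ => 𝒢.mul₀ p.1 p.2.1) (𝓝 (𝒢.one, 𝒢.one, 𝒢.one))
        (𝓝 𝒢.one) := hmul.comp (by
      have : Continuous (fun p : C₀ × C₀ × C₀ => (p.1, p.2.1)) := by fun_prop
      exact this.tendsto (𝒢.one, 𝒢.one, 𝒢.one))
    have h23 : Tendsto (fun p : C₀ × C₀ × C₀ => 𝒢.mul₀ p.2.1 p.2.2) (𝓝 (𝒢.one, 𝒢.one, 𝒢.one))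
        (𝓝 𝒢.one) := hmul.comp (by
      have : Continuous (fun p : C₀ × C₀ × C₀ => (p.2.1, p.2.2)) := by fun_prop
      exact this.tendsto (𝒢.one, 𝒢.one, 𝒢.one))
    have hp1 : Tendsto (fun p : C₀ × C₀ × C₀ => p.1) (𝓝 (𝒢.one, 𝒢.one, 𝒢.one)) (𝓝 𝒢.one) :=
      continuousAt_fst
    have hp3 : Tendsto (fun p : C₀ × C₀ × C₀ => p.2.2) (𝓝 (𝒢.one, 𝒢.one, 𝒢.one)) (𝓝 𝒢.one) := by
      have : Continuous (fun p : C₀ × C₀ × C₀ => p.2.2) := by fun_prop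
      exact this.tendsto (𝒢.one, 𝒢.one, 𝒢.one)
    have hl : Tendsto (fun p : C₀ × C₀ × C₀ => 𝒢.mul₀ (𝒢.mul₀ p.1 p.2.1) p.2.2)
        (𝓝 (𝒢.one, 𝒢.one, 𝒢.one)) (𝓝 𝒢.one) := hmul.comp (h12.prodMk_nhds hp3)
    have hr : Tendsto (fun p : C₀ × C₀ × C₀ => 𝒢.mul₀ p.1 (𝒢.mul₀ p.2.1 p.2.2))
        (𝓝 (𝒢.one, 𝒢.one, 𝒢.one)) (𝓝 𝒢.one) := hmul.comp (hp1.prodMk_nhds h23)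
    filter_upwards [ht3.eventually h.assoc, ht3.eventually (h12.eventually hsrc),
      ht3.eventually (h23.eventually hsrc), ht3.eventually (hl.eventually hsrc),
      ht3.eventually (hr.eventually hsrc),
      ht3.eventually ((h.inv.tendsto.comp hl).eventually hsrc)] with p h1 h2 h3 h4 h5 h6
    simp only [chartMul, coordRep]
    rw [φ.left_inv h3, φ.left_inv h2, φ.left_inv h5, φ.left_inv h4]
    refine congrArg φ (Eq.trans ?_ h1)
    exact congrArg _ (φ.left_inv h6)

theorem TwoGroup.IsWeaklyAssoc.isLCLieBracket (h : 𝒢.IsWeaklyAssoc) :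
    IsLCLieBracket 𝒢.lieBracket := by
  rw [TwoGroup.lieBracket_eq h.mul]
  exact h.isWeaklyAssocMul.isLCLieBracket

/-- The differential of a map that is multiplicative on objects near the unit preserves the
brackets. -/
theorem TwoGroup.pointedDiff_lieBracket {D₀ D₁ : Type u} [TopologicalSpace D₀] [LCManifold D₀]
    {ℋ : TwoGroup D₀ D₁}
    (h𝒢 : IsSmoothGerm (fun p : C₀ × C₀ => 𝒢.mul₀ p.1 p.2) (𝒢.one, 𝒢.one) 𝒢.one)
    (hℋ : IsSmoothGerm (fun p : D₀ × D₀ => ℋ.mul₀ p.1 p.2) (ℋ.one, ℋ.one) ℋ.one)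
    {f : C₀ → D₀} (hf : IsSmoothGerm f 𝒢.one ℋ.one)
    (hmul : ∀ x y, f (𝒢.mul₀ x y) = ℋ.mul₀ (f x) (f y)) (x y : Model C₀) :
    pointedDiff f 𝒢.one ℋ.one (𝒢.lieBracket x y) =
      ℋ.lieBracket (pointedDiff f 𝒢.one ℋ.one x) (pointedDiff f 𝒢.one ℋ.one y) := by
  rw [TwoGroup.lieBracket_eq h𝒢, TwoGroup.lieBracket_eq hℋ]
  refine (TwoGroup.isLocalUnitalMul h𝒢).dirDeriv_bracket (TwoGroup.isLocalUnitalMul hℋ) hf.smooth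
    (coordRep_self hf.map_eq) ?_ x y
  have ht := tendsto_chartAt_symm 𝒢.one
  have ht2 : Tendsto (fun p : Model C₀ × Model C₀ => ((chartAt (Model C₀) 𝒢.one).symm p.1,
      (chartAt (Model C₀) 𝒢.one).symm p.2)) (𝓝 (𝒢.chartOne, 𝒢.chartOne))
      (𝓝 (𝒢.one, 𝒢.one)) := by
    simp only [nhds_prod_eq]
    exact ht.prodMap ht
  have hfst : Tendsto (fun p : C₀ × C₀ => p.1) (𝓝 (𝒢.one, 𝒢.one)) (𝓝 𝒢.one) := continuousAt_fst
  have hsnd : Tendsto (fun p : C₀ × C₀ => p.2) (𝓝 (𝒢.one, 𝒢.one)) (𝓝 𝒢.one) := continuousAt_snd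
  filter_upwards [ht2.eventually (h𝒢.tendsto.eventually (eventually_mem_chartAt_source _)),
    ht2.eventually ((hf.tendsto.comp hfst).eventually (eventually_mem_chartAt_source _)),
    ht2.eventually ((hf.tendsto.comp hsnd).eventually (eventually_mem_chartAt_source _))]
    with p h1 h2 h3
  simp only [chartMul, coordRep]
  rw [(chartAt (Model C₀) 𝒢.one).left_inv h1, hmul]
  refine congrArg _ (congrArg₂ _ ?_ ?_)
  · exact ((chartAt (Model D₀) ℋ.one).left_inv h2).symm
  · exact ((chartAt (Model D₀) ℋ.one).left_inv h3).symm

/-- The differential of a map with central values has central values. -/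
theorem TwoGroup.lieBracket_pointedDiff_eq_zero {N : Type u} [TopologicalSpace N] [LCManifold N]
    (h𝒢 : IsSmoothGerm (fun p : C₀ × C₀ => 𝒢.mul₀ p.1 p.2) (𝒢.one, 𝒢.one) 𝒢.one)
    {f : N → C₀} {n : N} (hf : IsSmoothGerm f n 𝒢.one)
    (hcomm : ∀ z x, 𝒢.mul₀ (f z) x = 𝒢.mul₀ x (f z)) (z : Model N) (x : Model C₀) :
    𝒢.lieBracket (pointedDiff f n 𝒢.one z) x = 0 := by
  have hm := TwoGroup.isLocalUnitalMul h𝒢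
  have h1 := mixedDeriv_comp_prodMap hm.smooth hf.smooth (isCInftyAt_id 𝒢.chartOne)
    (coordRep_self hf.map_eq) rfl z x
  have h2 := mixedDeriv_comp_prodMap hm.swap.smooth hf.smooth (isCInftyAt_id 𝒢.chartOne)
    (coordRep_self hf.map_eq) rfl z x
  rw [dirDeriv_id] at h1 h2
  rw [mixedDeriv_swap hm.smooth] at h2
  rw [TwoGroup.lieBracket_eq h𝒢]
  refine sub_eq_zero.2 (h1.symm.trans (Eq.trans ?_ h2))
  refine congrFun (congrFun (mixedDeriv_congr ?_) z) x
  have ht : Tendsto (fun p : Model N × Model C₀ => (chartAt (Model N) n).symm p.1)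
      (𝓝 (chartAt (Model N) n n, 𝒢.chartOne)) (𝓝 n) :=
    (tendsto_chartAt_symm n).comp continuousAt_fst
  filter_upwards [ht.eventually (hf.tendsto.eventually (eventually_mem_chartAt_source _))] with p hp
  simp only [chartMul, coordRep]
  rw [(chartAt (Model C₀) 𝒢.one).left_inv hp, hcomm]

end TwoGroupLie

/-! ### The discrete 2-group of a Lie group and the 2-group of a homomorphism -/

section Examples

variable {A Z G : Type u}
  [AddCommGroup A] [TopologicalSpace A] [LCManifold A] [DiscreteTopology A]
  [AddCommGroup Z] [TopologicalSpace Z] [LCManifold Z] [IsLCLieAddGroup Z]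
  [Group G] [TopologicalSpace G] [LCManifold G] [IsLCLieGroup G]

theorem isWeaklyAssoc_discreteTwoGroup : (discreteTwoGroup G).IsWeaklyAssoc where
  mul := IsLCLieGroup.smooth_mul.isSmoothGerm (mul_one (1 : G))
  inv := IsLCLieGroup.smooth_inv.isSmoothGerm (inv_one (G := G))
  assoc := Eventually.of_forall fun p => by
    change p.1 * (p.2.1 * p.2.2) * (p.1 * p.2.1 * p.2.2)⁻¹ = 1
    rw [← mul_assoc, mul_inv_cancel]

theorem tangentDiscrete_discreteTwoGroup : (discreteTwoGroup G).TangentDiscrete :=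
  have h : ∀ x : Model G, pointedDiff (fun g : G => g) 1 1 x = x := pointedDiff_id (1 : G)
  ⟨fun x => (h _).trans (h x), fun x => (h _).trans (h x), fun _ => rfl⟩

theorem isWeaklyAssoc_abelianTwoGroup (τ : A →+ Z) : (abelianTwoGroup τ).IsWeaklyAssoc where
  mul := IsLCLieAddGroup.smooth_add.isSmoothGerm (add_zero (0 : Z))
  inv := IsLCLieAddGroup.smooth_neg.isSmoothGerm (neg_zero (G := Z))
  assoc := Eventually.of_forall fun p => by
    change p.1 + (p.2.1 + p.2.2) + -(p.1 + p.2.1 + p.2.2) = 0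
    rw [← add_assoc, add_neg_cancel]

theorem lieBracket_abelianTwoGroup (τ : A →+ Z) (x y : Model Z) :
    (abelianTwoGroup τ).lieBracket x y = 0 := by
  have hmul := (isWeaklyAssoc_abelianTwoGroup τ).mul
  rw [TwoGroup.lieBracket_eq hmul]
  refine sub_eq_zero.2 ?_
  rw [← mixedDeriv_swap (TwoGroup.isLocalUnitalMul hmul).smooth]
  have hswap : (fun p : Model Z × Model Z => (abelianTwoGroup τ).chartMul (p.2, p.1)) =
      (abelianTwoGroup τ).chartMul :=
    funext fun p => congrArg (chartAt (Model Z) (0 : Z)) (add_comm (G := Z) _ _)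
  rw [hswap]

/-- As `A` is discrete, every morphism near the unit is an identity. -/
theorem tangentDiscrete_abelianTwoGroup (τ : A →+ Z) : (abelianTwoGroup τ).TangentDiscrete := by
  have hs : IsSmoothGerm (fun f : A × Z => f.2) (0, 0) 0 := isSmoothGerm_snd 0 0
  have hi : IsSmoothGerm (fun x : Z => ((0 : A), x)) 0 (0, 0) :=
    (isSmoothGerm_const 0 0).prodMk (isSmoothGerm_id 0)
  have hA : ∀ᶠ f : A × Z in 𝓝 (0, 0), f.1 = 0 :=
    (continuous_fst.tendsto ((0, 0) : A × Z)).eventually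
      (IsOpen.mem_nhds (isOpen_discrete {(0 : A)}) rfl)
  refine ⟨fun x => ?_, fun y => ?_, fun y => ?_⟩
  · refine (pointedDiff_comp hs hi x).symm.trans ?_
    exact pointedDiff_id (0 : Z) x
  · refine (pointedDiff_comp hi hs y).symm.trans ?_
    rw [pointedDiff_congr (g := fun f : A × Z => f) ((0, 0) : A × Z)]
    · exact pointedDiff_id ((0, 0) : A × Z) y
    · filter_upwards [hA] with f hf
      rw [← hf]
  · refine congrFun (pointedDiff_congr _ ?_) y
    filter_upwards [hA] with f hf
    change τ f.1 + f.2 = f.2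
    rw [hf, map_zero, zero_add]

end Examples

/-! ### Germs of the structure maps of a Lie 2-group -/

section LieTwoGroup

variable {C₀ C₁ D₀ D₁ : Type u}
  [TopologicalSpace C₀] [LCManifold C₀] [TopologicalSpace C₁] [LCManifold C₁]
  [TopologicalSpace D₀] [LCManifold D₀] [TopologicalSpace D₁] [LCManifold D₁]
  {𝒢 : TwoGroup C₀ C₁} {ℋ : TwoGroup D₀ D₁}

namespace TwoGroup.IsLie

theorem src (h : 𝒢.IsLie) : IsSmoothGerm 𝒢.src (𝒢.idm 𝒢.one) 𝒢.one :=
  h.smoothTwoSpace.smooth_src.isSmoothGerm (𝒢.src_idm _)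

theorem tgt (h : 𝒢.IsLie) : IsSmoothGerm 𝒢.tgt (𝒢.idm 𝒢.one) 𝒢.one :=
  h.smoothTwoSpace.smooth_tgt.isSmoothGerm (𝒢.tgt_idm _)

theorem idm (h : 𝒢.IsLie) : IsSmoothGerm 𝒢.idm 𝒢.one (𝒢.idm 𝒢.one) :=
  h.smoothTwoSpace.smooth_idm.isSmoothGerm rfl

theorem mul₀ (h : 𝒢.IsLie) :
    IsSmoothGerm (fun p : C₀ × C₀ => 𝒢.mul₀ p.1 p.2) (𝒢.one, 𝒢.one) 𝒢.one := by
  obtain ⟨U₀, U₁, hU, h1, hm, -⟩ := h.locallySmooth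
  exact hm.isSmoothGerm (hU.isOpen_obj.prod hU.isOpen_obj) ⟨h1, h1⟩ (𝒢.mul_one₀ _)

theorem mul₁ (h : 𝒢.IsLie) :
    IsSmoothGerm (fun p : C₁ × C₁ => 𝒢.mul₁ p.1 p.2) (𝒢.idm 𝒢.one, 𝒢.idm 𝒢.one)
      (𝒢.idm 𝒢.one) := by
  obtain ⟨U₀, U₁, hU, h1, -, hm, -⟩ := h.locallySmooth
  exact hm.isSmoothGerm (hU.isOpen_mor.prod hU.isOpen_mor)
    ⟨hU.idm_mem _ h1, hU.idm_mem _ h1⟩ (𝒢.mul_one₁ _)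

theorem inv₀ (h : 𝒢.IsLie) : IsSmoothGerm 𝒢.inv₀ 𝒢.one 𝒢.one := by
  obtain ⟨U₀, U₁, hU, h1, -, -, hi, -⟩ := h.locallySmooth
  exact hi.isSmoothGerm hU.isOpen_obj h1 𝒢.inv_one₀

theorem tendsto_assoc (h : 𝒢.IsLie) :
    Tendsto (fun p : C₀ × C₀ × C₀ => 𝒢.assoc p.1 p.2.1 p.2.2) (𝓝 (𝒢.one, 𝒢.one, 𝒢.one))
      (𝓝 (𝒢.idm 𝒢.one)) := by
  obtain ⟨U₀, U₁, hU, h1, -, -, -, -, ha, -⟩ := h.locallySmooth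
  exact (ha.isSmoothGerm (hU.isOpen_obj.prod (hU.isOpen_obj.prod hU.isOpen_obj)) ⟨h1, h1, h1⟩
    (by rw [𝒢.assoc_one_left, 𝒢.mul_one₀])).tendsto

end TwoGroup.IsLie

theorem TwoGroupHom.IsLie.obj {F : TwoGroupHom 𝒢 ℋ} (hF : F.IsLie) :
    IsSmoothGerm F.obj 𝒢.one ℋ.one := by
  obtain ⟨U₀, U₁, hU, h1, ho, -⟩ := hF
  exact ho.isSmoothGerm hU.isOpen_obj h1 F.obj_one

end LieTwoGroup

/-! ### Morphisms into a discrete 2-group -/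

section HomToDiscrete

variable {C₀ C₁ G : Type u} [Group G] {𝒢 : TwoGroup C₀ C₁}

theorem TwoGroupHom.mor_eq_obj_src (q : TwoGroupHom 𝒢 (discreteTwoGroup G)) (f : C₁) :
    q.mor f = q.obj (𝒢.src f) := q.src_mor f

theorem TwoGroupHom.obj_mul (q : TwoGroupHom 𝒢 (discreteTwoGroup G)) (x y : C₀) :
    q.obj (𝒢.mul₀ x y) = q.obj x * q.obj y := (q.tgt_mul₂ x y).symm.trans (q.src_mul₂ x y)

theorem TwoGroupHom.obj_inv (q : TwoGroupHom 𝒢 (discreteTwoGroup G)) (x : C₀) :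
    q.obj (𝒢.inv₀ x) = (q.obj x)⁻¹ := by
  refine eq_inv_of_mul_eq_one_right ?_
  rw [← q.obj_mul, 𝒢.mul_inv₀]
  exact q.obj_one

end HomToDiscrete

/-! ### Smooth generalised central extensions -/

section Extension

variable {A Z G C₀ C₁ : Type u}
  [AddCommGroup A] [TopologicalSpace A] [LCManifold A] [DiscreteTopology A]
  [AddCommGroup Z] [TopologicalSpace Z] [LCManifold Z]
  [Group G] [TopologicalSpace G] [LCManifold G]
  [TopologicalSpace C₀] [LCManifold C₀] [TopologicalSpace C₁] [LCManifold C₁]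
  {τ : A →+ Z} {𝒢 : TwoGroup C₀ C₁}
  {ι : TwoGroupHom (abelianTwoGroup τ) 𝒢} {q : TwoGroupHom 𝒢 (discreteTwoGroup G)}

theorem TwoGroupHom.mor_zero_left (ι : TwoGroupHom (abelianTwoGroup τ) 𝒢) (z : Z) :
    ι.mor (0, z) = 𝒢.idm (ι.obj z) := ι.mor_idm z

theorem TwoGroupHom.mor_zero_zero (ι : TwoGroupHom (abelianTwoGroup τ) 𝒢) :
    ι.mor (0, 0) = 𝒢.idm 𝒢.one := by
  rw [ι.mor_zero_left]
  exact congrArg _ ι.obj_one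

namespace IsSmoothGenCentralExt

/-- Near the unit, `q` has only identities of objects `ι z` in its kernel: such a morphism is
`ι (a, z)`, where `a` depends continuously on it and vanishes at the unit, so `a = 0` as `A` is
discrete.  The component `z` is given by the local inverse of `ι`. -/
theorem exists_retraction (h : IsSmoothGenCentralExt ι q) :
    ∃ r : C₁ → Z, IsSmoothGerm r (𝒢.idm 𝒢.one) 0 ∧
      ∀ᶠ k in 𝓝 (𝒢.idm 𝒢.one), (q.mor k = 1 → k = 𝒢.idm (ι.obj (r k))) ∧
        ∀ z, 𝒢.idm (ι.obj z) = k → r k = z := by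
  obtain ⟨N, r, hN, h1, hr, hinv⟩ := h.embedding_ι
  have hr1 : r (𝒢.idm 𝒢.one) = (0, 0) := by
    rw [← ι.mor_zero_zero] at h1 ⊢
    exact hinv _ h1
  have hr' := hr.isSmoothGerm hN h1 hr1
  have hA : ∀ᶠ f : A × Z in 𝓝 (0, 0), f.1 = 0 :=
    (continuous_fst.tendsto ((0, 0) : A × Z)).eventually
      (IsOpen.mem_nhds (isOpen_discrete {(0 : A)}) rfl)
  refine ⟨fun k => (r k).2, (isSmoothGerm_snd 0 0).comp hr', ?_⟩
  filter_upwards [hN.mem_nhds h1, hr'.tendsto.eventually hA] with k hk hk0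
  refine ⟨fun hqk => ?_, fun z hz => ?_⟩
  · obtain ⟨⟨a, z⟩, rfl⟩ := (h.exact_mor k).2 hqk
    rw [hinv _ hk] at hk0 ⊢
    obtain rfl : a = 0 := hk0
    exact ι.mor_zero_left z
  · rw [← ι.mor_zero_left] at hz
    subst hz
    rw [hinv _ hk]

/-- A morphism `f` near the unit satisfies `f ⊗ inv (id (src f)) = id 𝟙`, since it lies in the
kernel of `q` and starts at the unit. -/
theorem eventually_mul_inv_idm_src (h : IsSmoothGenCentralExt ι q) :
    ∀ᶠ f in 𝓝 (𝒢.idm 𝒢.one), 𝒢.mul₁ f (𝒢.idm (𝒢.inv₀ (𝒢.src f))) = 𝒢.idm 𝒢.one := by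
  obtain ⟨r, -, hr⟩ := h.exists_retraction
  have ht := (h.lie.mul₁.comp ((isSmoothGerm_id _).prodMk
    (h.lie.idm.comp (h.lie.inv₀.comp h.lie.src)))).tendsto
  filter_upwards [ht.eventually hr] with f hf
  have hsrc : 𝒢.src (𝒢.mul₁ f (𝒢.idm (𝒢.inv₀ (𝒢.src f)))) = 𝒢.one := by
    rw [𝒢.src_mul, 𝒢.src_idm, 𝒢.mul_inv₀]
  have hk := hf.1 (by rw [q.mor_eq_obj_src, hsrc]; exact q.obj_one)
  have hs := congrArg 𝒢.src hk
  rw [hsrc, 𝒢.src_idm] at hs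
  rw [hk, ← hs]

theorem eventually_mul_tgt_inv_src (h : IsSmoothGenCentralExt ι q) :
    ∀ᶠ f in 𝓝 (𝒢.idm 𝒢.one), 𝒢.mul₀ (𝒢.tgt f) (𝒢.inv₀ (𝒢.src f)) = 𝒢.one := by
  filter_upwards [h.eventually_mul_inv_idm_src] with f hf
  have := congrArg 𝒢.tgt hf
  rwa [𝒢.tgt_mul, 𝒢.tgt_idm, 𝒢.tgt_idm] at this

/-- The associator of objects near the unit is a morphism near the unit. -/
theorem isWeaklyAssoc (h : IsSmoothGenCentralExt ι q) : 𝒢.IsWeaklyAssoc where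
  mul := h.lie.mul₀
  inv := h.lie.inv₀
  assoc := by
    filter_upwards [h.lie.tendsto_assoc.eventually h.eventually_mul_tgt_inv_src] with p hp
    rwa [𝒢.src_assoc, 𝒢.tgt_assoc] at hp

/-- The differentials of the identities `f ⊗ inv (id (src f)) = id 𝟙` and
`tgt f ⊗ inv (src f) = 𝟙` at the unit. -/
theorem tangentDiscrete (h : IsSmoothGenCentralExt ι q) : 𝒢.TangentDiscrete := by
  have hinv := pointedDiff_inv 𝒢.mul_one₀ 𝒢.one_mul₀ 𝒢.mul_inv₀ h.lie.mul₀ h.lie.inv₀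
  have his := h.lie.inv₀.comp h.lie.src
  refine ⟨fun x => ?_, fun y => ?_, fun y => ?_⟩
  · rw [← pointedDiff_comp h.lie.src h.lie.idm]
    simp only [𝒢.src_idm]
    exact pointedDiff_id _ x
  · have e1 := congrFun (pointedDiff_congr (𝒢.idm 𝒢.one) h.eventually_mul_inv_idm_src) y
    rw [pointedDiff_mul 𝒢.mul_one₁ 𝒢.one_mul₁ h.lie.mul₁ (isSmoothGerm_id _)
      (h.lie.idm.comp his), pointedDiff_id, pointedDiff_const, pointedDiff_comp h.lie.idm his,
      pointedDiff_comp h.lie.inv₀ h.lie.src, hinv, h.lie.idm.isLinearMap.map_neg] at e1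
    exact (add_neg_eq_zero.1 e1).symm
  · have e1 := congrFun (pointedDiff_congr 𝒢.one h.eventually_mul_tgt_inv_src) y
    rw [pointedDiff_mul 𝒢.mul_one₀ 𝒢.one_mul₀ h.lie.mul₀ h.lie.tgt his, pointedDiff_const,
      pointedDiff_comp h.lie.inv₀ h.lie.src, hinv] at e1
    exact add_neg_eq_zero.1 e1

theorem obj_ι_comm (h : IsSmoothGenCentralExt ι q) (z : Z) (x : C₀) :
    𝒢.mul₀ (ι.obj z) x = 𝒢.mul₀ x (ι.obj z) := by
  have := h.central (0, z) (𝒢.idm x)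
  rw [ι.mor_zero_left, 𝒢.idm_mul, 𝒢.idm_mul] at this
  exact 𝒢.idm_injective this

theorem obj_q_obj_ι (h : IsSmoothGenCentralExt ι q) (z : Z) : q.obj (ι.obj z) = 1 := by
  rw [← (h.exact_mor (ι.mor (0, z))).1 ⟨_, rfl⟩, ι.mor_zero_left, q.mor_eq_obj_src, 𝒢.src_idm]

theorem exists_section (h : IsSmoothGenCentralExt ι q) :
    ∃ σ : G → C₀, IsSmoothGerm σ 1 𝒢.one ∧ ∀ᶠ g in 𝓝 (1 : G), q.obj (σ g) = g := by
  obtain ⟨U, σ, hU, h1, hσ, hσ1, hq⟩ := h.section_q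
  exact ⟨σ, hσ.isSmoothGerm hU h1 hσ1, by filter_upwards [hU.mem_nhds h1] with g hg using hq g hg⟩

theorem lieMap_q_lieMap_ι (h : IsSmoothGenCentralExt ι q) (z : Model Z) :
    q.lieMap (ι.lieMap z) = 0 := by
  refine (pointedDiff_comp h.lie_q.obj h.lie_ι.obj z).symm.trans ?_
  simp only [h.obj_q_obj_ι]
  exact pointedDiff_const _ _ z

/-- An object `x` near the unit is `ι z` up to a factor `σ (q x)`; differentiating `z` as a
function of `x` exhibits `ker 𝓛(q)` as the image of `𝓛(ι)`. -/
theorem mem_range_lieMap_ι (h : IsSmoothGenCentralExt ι q) {x : Model C₀} (hx : q.lieMap x = 0) :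
    x ∈ range ι.lieMap := by
  obtain ⟨r, hr, hker⟩ := h.exists_retraction
  obtain ⟨σ, hσ, hqσ⟩ := h.exists_section
  have hq : IsSmoothGerm q.obj 𝒢.one (1 : G) := h.lie_q.obj
  have hι : IsSmoothGerm ι.obj (0 : Z) 𝒢.one := h.lie_ι.obj
  have hσq := hσ.comp hq
  have hinv := h.lie.inv₀.comp hσq
  have hd : IsSmoothGerm (fun u => 𝒢.mul₀ u (𝒢.inv₀ (σ (q.obj u)))) 𝒢.one 𝒢.one :=
    h.lie.mul₀.comp ((isSmoothGerm_id _).prodMk hinv)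
  have hidm := h.lie.idm.comp hd
  have hc := hr.comp hidm
  have hev : ∀ᶠ u in 𝓝 𝒢.one, 𝒢.mul₀ u (𝒢.inv₀ (σ (q.obj u))) =
      ι.obj (r (𝒢.idm (𝒢.mul₀ u (𝒢.inv₀ (σ (q.obj u)))))) := by
    filter_upwards [hidm.tendsto.eventually hker, hq.tendsto.eventually hqσ] with u hu hqu
    refine 𝒢.idm_injective (hu.1 ?_)
    rw [q.mor_eq_obj_src, 𝒢.src_idm, q.obj_mul, q.obj_inv, hqu, mul_inv_cancel]
  have e := congrFun (pointedDiff_congr 𝒢.one hev) x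
  have hx' : pointedDiff q.obj 𝒢.one (1 : G) x = 0 := hx
  rw [pointedDiff_mul 𝒢.mul_one₀ 𝒢.one_mul₀ h.lie.mul₀ (isSmoothGerm_id _) hinv, pointedDiff_id,
    pointedDiff_comp h.lie.inv₀ hσq, pointedDiff_comp hσ hq, hx', hσ.isLinearMap.map_zero,
    h.lie.inv₀.isLinearMap.map_zero, add_zero, pointedDiff_comp hι hc] at e
  exact ⟨_, e.symm⟩

/-- The differential of the local inverse of `ι` is a continuous left inverse of `𝓛(ι)`. -/
theorem isEmbedding_lieMap_ι (h : IsSmoothGenCentralExt ι q) : IsEmbedding ι.lieMap := by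
  obtain ⟨r, hr, hker⟩ := h.exists_retraction
  have hι : IsSmoothGerm ι.obj (0 : Z) 𝒢.one := h.lie_ι.obj
  have hri := hr.comp h.lie.idm
  have hev : ∀ᶠ z in 𝓝 (0 : Z), r (𝒢.idm (ι.obj z)) = z := by
    filter_upwards [(h.lie.idm.comp hι).tendsto.eventually hker] with z hz using hz.2 z rfl
  refine Function.LeftInverse.isEmbedding
    (f := pointedDiff (fun x => r (𝒢.idm x)) 𝒢.one (0 : Z)) (fun z => ?_)
    hri.continuous_pointedDiff hι.continuous_pointedDiff
  refine (pointedDiff_comp hri hι z).symm.trans ?_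
  rw [pointedDiff_congr (0 : Z) hev, pointedDiff_id]

/-- The differential of a local section of `q` is a continuous linear section of `𝓛(q)`. -/
theorem exists_clm_section (h : IsSmoothGenCentralExt ι q) :
    ∃ s : Model G →L[ℝ] Model C₀, ∀ y, q.lieMap (s y) = y := by
  obtain ⟨σ, hσ, hqσ⟩ := h.exists_section
  have hq : IsSmoothGerm q.obj 𝒢.one (1 : G) := h.lie_q.obj
  refine ⟨⟨hσ.isLinearMap.mk' _, hσ.continuous_pointedDiff⟩, fun y => ?_⟩
  refine (pointedDiff_comp hq hσ y).symm.trans ?_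
  rw [pointedDiff_congr (1 : G) hqσ, pointedDiff_id]

end IsSmoothGenCentralExt

end Extension

theorem mainTheorem5 {A Z G C₀ C₁ : Type u}
    [AddCommGroup A] [TopologicalSpace A] [LCManifold A] [IsLCLieAddGroup A] [DiscreteTopology A]
    [AddCommGroup Z] [TopologicalSpace Z] [LCManifold Z] [IsLCLieAddGroup Z]
    [Group G] [TopologicalSpace G] [LCManifold G] [IsLCLieGroup G]
    [TopologicalSpace C₀] [LCManifold C₀] [TopologicalSpace C₁] [LCManifold C₁]
    (τ : A →+ Z) (hτ : SmoothMap τ) (𝒢 : TwoGroup C₀ C₁)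
    (ι : TwoGroupHom (abelianTwoGroup τ) 𝒢) (q : TwoGroupHom 𝒢 (discreteTwoGroup G))
    (h : IsSmoothGenCentralExt ι q) :
    (abelianTwoGroup τ).TangentDiscrete ∧ 𝒢.TangentDiscrete ∧
      (discreteTwoGroup G).TangentDiscrete ∧
      IsCentralLieExtension (abelianTwoGroup τ).lieBracket 𝒢.lieBracket
        (discreteTwoGroup G).lieBracket ι.lieMap q.lieMap := by
  have central : ∀ z x, 𝒢.lieBracket (ι.lieMap z) x = 0 :=
    TwoGroup.lieBracket_pointedDiff_eq_zero h.lie.mul₀ h.lie_ι.obj h.obj_ι_comm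
  obtain ⟨s, hs⟩ := h.exists_clm_section
  exact ⟨tangentDiscrete_abelianTwoGroup τ, h.tangentDiscrete, tangentDiscrete_discreteTwoGroup,
    { lie₁ := (isWeaklyAssoc_abelianTwoGroup τ).isLCLieBracket
      lie₂ := h.isWeaklyAssoc.isLCLieBracket
      lie₃ := isWeaklyAssoc_discreteTwoGroup.isLCLieBracket
      hom_i :=
        { isLinear := h.lie_ι.obj.isLinearMap
          continuous_map := h.lie_ι.obj.continuous_pointedDiff
          map_br := fun x y => by
            rw [lieBracket_abelianTwoGroup, central]
            exact h.lie_ι.obj.isLinearMap.map_zero }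
      hom_p :=
        { isLinear := h.lie_q.obj.isLinearMap
          continuous_map := h.lie_q.obj.continuous_pointedDiff
          map_br := TwoGroup.pointedDiff_lieBracket h.lie.mul₀ isWeaklyAssoc_discreteTwoGroup.mul
            h.lie_q.obj q.obj_mul }
      embedding_i := h.isEmbedding_lieMap_ι
      exact := fun x => ⟨h.mem_range_lieMap_ι, by rintro ⟨z, rfl⟩; exact h.lieMap_q_lieMap_ι z⟩
      surjective_p := fun y => ⟨s y, hs y⟩
      central := central
      split := ⟨s, hs⟩ }⟩
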